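/- **Setting.** Let $n\ge 1$, let $V$ be a real vector space of dimension $4n$, and put $\epsilon_1=1$, $\epsilon_2=\epsilon_3=-1$. A para-hypercomplex structure on $V$ is a triple $\mathcal H=(J_1,J_2,J_3)$ of endomorphisms of $V$ with $J_\alpha^2=-\epsilon_\alpha \mathrm{Id}$ and $J_\beta J_\gamma=-\epsilon_\alpha J_\alpha$ for every cyclic permutation $(\alpha,\beta,\gamma)$ of $(1,2,3)$. A Lie subalgebra $\mathcal G\subset \mathrm{End}(V)$ is a para-quaternionic structure if it has such a triple as a basis; then $\mathcal H$ is said to correspond to $\mathcal G$. Let $$aut(\mathcal G)=\{L\in\mathrm{End}(V): [L,\mathcal G]\subset\mathcal G\},\qquad aut(\mathcal H)=\{L\in\mathrm{End}(V): [L,J_\alpha]=0,\ \alpha=1,2,3\};$$ these are isomorphic to $gl_{2n}(\mathbb R)\oplus sp(1,\mathbb R)$ and $gl_{2n}(\mathbb R)$, respectively. For a Lie subalgebra $\mathcal L\subset\mathrm{End}(V)$ let $\mathcal R(\mathcal L)$ be the space of $\mathcal L$-valued $2$-forms $R$ on $V$ with $R(X,Y)Z+R(Y,Z)X+R(Z,X)Y=0$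 for all $X,Y,Z\in V$. Subalgebras of $\mathrm{End}(V)$ act on $\mathrm{End}(V)$-valued bilinear maps $R$ on $V$ by $$(L\cdot R)(X,Y)=[L,R(X,Y)]-R(LX,Y)-R(X,LY).$$ Let $Ric(R)(Y,Z)=\mathrm{Tr}(X\mapsto R(X,Y)Z)$ and $$\mathcal W=\{R\in\mathcal R(aut(\mathcal G)): Ric(R)=0\}.$$ Let $Bil(V)$ be the space of bilinear forms on $V$, and $S^2$, $\Lambda^2$ its subspaces of symmetric and antisymmetric forms. Let $S^2_{\mathcal G}$, $\Lambda^2_{\mathcal G}$ be the spaces of symmetric and antisymmetric forms $B$ with $B(JX,Y)=-B(X,JY)$ for all $J\in\mathcal G$, $X,Y\in V$. With $$\Pi_{\mathcal G}(B)(X,Y)=\tfrac14\Bigl(B(X,Y)+\sum_{\alpha=1}^3\epsilon_\alpha B(J_\alpha X,J_\alpha Y)\Bigr)$$ let $S^2_{mix}=(\mathrm{Id}-\Pi_{\mathcal G})(S^2)$ and $\Lambda^2_{mix}=(\mathrm{Id}-\Pi_{\mathcal G})(\Lambda^2)$. For $B\in Bil(V)$ put $$\begin{aligned}R^B(X,Y)Z={}&(B(Y,X)-B(X,Y))Z+B(Y,Z)X-B(X,Z)Y\\&+\sum_{\alpha=1}^3\epsilon_\alpha\bigl((B(X,J_\alpha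 Y)-B(Y,J_\alpha X))J_\alpha Z+B(X,J_\alpha Z)J_\alpha Y-B(Y,J_\alpha Z)J_\alpha X\bigr),\end{aligned}$$ and let $\mathcal R(S^2_h)$, $\mathcal R(S^2_{mix})$, $\mathcal R(\Lambda^2_h)$, $\mathcal R(\Lambda^2_{mix})$ be the images of $S^2_{\mathcal G}$, $S^2_{mix}$, $\Lambda^2_{\mathcal G}$, $\Lambda^2_{mix}$, respectively, under $B\mapsto R^B$. **Theorem 4.1.** Let $\mathcal G$ be a para-quaternionic structure on $V$ and $\mathcal H=(J_1,J_2,J_3)$ a corresponding para-hypercomplex structure. (i) For every $n\ge1$ there is a direct sum decomposition into $aut(\mathcal G)$-submodules $$\mathcal R(aut(\mathcal G))=\mathcal W\oplus\mathcal R(S^2_h)\oplus\mathcal R(S^2_{mix})\oplus\mathcal R(\Lambda^2_h)\oplus\mathcal R(\Lambda^2_{mix}),$$ and the last four summands are irreducible $aut(\mathcal G)$-modules. If $n\ge2$, then $\mathcal W$ is an irreducible $aut(\mathcal G)$-module as well. If $n=1$, then there is a para-quaternionic structure $\mathcal G'$ on $V$ with $[\mathcal G,\mathcal G']=0$ and $aut(\mathcal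 G)=\mathbb R\,\mathrm{Id}\oplus\mathcal G\oplus\mathcal G'$, and for every such $\mathcal G'$ $$\mathcal W=\mathcal W_+\oplus\mathcal W_-,\qquad \mathcal W_+=\mathcal R(\mathcal G),\quad \mathcal W_-=\mathcal R(\mathcal G'),$$ where both summands are irreducible $aut(\mathcal G)$-modules. (ii) There are direct sum decompositions into irreducible $aut(\mathcal H)$-modules $$\mathcal R(aut(\mathcal H))=\mathcal W\oplus\mathcal R(\Lambda^2_h)\quad(n\ge2),\qquad \mathcal R(aut(\mathcal H))=\mathcal W_-\oplus\mathcal R(\Lambda^2_h)\quad(n=1).$$ -/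

import Mathlib

set_option maxSynthPendingDepth 3

attribute [local instance 100] LieRing.ofAssociativeRing

namespace ParaQuaternion

variable {V : Type*} [AddCommGroup V] [Module ℝ V]

/-- The signs `ε₁ = 1`, `ε₂ = ε₃ = -1`; the indices `1, 2, 3` are the elements `0, 1, 2` of `Fin 3`. -/
def eps : Fin 3 → ℝ := ![1, -1, -1]

/-- Para-hypercomplex structure `(J₁, J₂, J₃)` on `V`: `J_α² = -ε_α Id` and `J_β J_γ = -ε_α J_α` for
every cyclic permutation `(α, β, γ)` of the three indices. -/
structure IsParahypercomplex (J : Fin 3 → Module.End ℝ V) : Prop where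
  sq : ∀ a, J a * J a = -eps a • (1 : Module.End ℝ V)
  mul : ∀ a, J (a + 1) * J (a + 2) = -eps a • J a

/-- The Lie subalgebra `G` of `End V` has the para-hypercomplex structure `J` as a basis. -/
structure Corresponds (G : LieSubalgebra ℝ (Module.End ℝ V)) (J : Fin 3 → Module.End ℝ V) :
    Prop where
  parahypercomplex : IsParahypercomplex J
  linearIndependent : LinearIndependent ℝ J
  span_eq : Submodule.span ℝ (Set.range J) = G.toSubmodule

/-- Para-quaternionic structure on `V`. -/
def IsParaquaternionic (G : LieSubalgebra ℝ (Module.End ℝ V)) : Prop :=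
  ∃ J : Fin 3 → Module.End ℝ V, Corresponds G J

/-- `aut(G)`: the maps `L` with `[L, A] ∈ G` for all `A ∈ G`. -/
def autG (G : LieSubalgebra ℝ (Module.End ℝ V)) : LieSubalgebra ℝ (Module.End ℝ V) :=
  G.normalizer

/-- `aut(H)` for `H = (J₁, J₂, J₃)`: the maps `L` with `[L, J_α] = 0` for all `α`. -/
def autH (J : Fin 3 → Module.End ℝ V) : LieSubalgebra ℝ (Module.End ℝ V) where
  carrier := {L | ∀ a, ⁅L, J a⁆ = 0}
  add_mem' := fun {A B} hA hB a => by
    have h1 : ⁅A, J a⁆ = 0 := hA a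
    have h2 : ⁅B, J a⁆ = 0 := hB a
    rw [add_lie, h1, h2, add_zero]
  zero_mem' := fun a => zero_lie _
  smul_mem' := fun c A hA a => by
    have h1 : ⁅A, J a⁆ = 0 := hA a
    rw [smul_lie, h1, smul_zero]
  lie_mem' := fun {A B} hA hB a => by
    have h1 : ⁅A, J a⁆ = 0 := hA a
    have h2 : ⁅B, J a⁆ = 0 := hB a
    rw [lie_lie, h1, h2, lie_zero, lie_zero, sub_zero]

theorem mem_autG (G : LieSubalgebra ℝ (Module.End ℝ V)) (L : Module.End ℝ V) :
    L ∈ autG G ↔ ∀ A ∈ G, ⁅L, A⁆ ∈ G := LieSubalgebra.mem_normalizer_iff G L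

/-- Bilinear forms on `V`. -/
abbrev Bil (V : Type*) [AddCommGroup V] [Module ℝ V] : Type _ := V →ₗ[ℝ] V →ₗ[ℝ] ℝ

/-- `End V`-valued bilinear maps `(X, Y) ↦ R(X, Y)` on `V`. Mathlib's Lie module structure over
subalgebras of `End V` is `(L · R)(X, Y) = [L, R(X, Y)] - R(L X, Y) - R(X, L Y)`. -/
abbrev Tens (V : Type*) [AddCommGroup V] [Module ℝ V] : Type _ :=
  V →ₗ[ℝ] V →ₗ[ℝ] Module.End ℝ V

theorem tens_lie_apply (A : LieSubalgebra ℝ (Module.End ℝ V)) (L : A) (R : Tens V) (X Y : V) :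
    ⁅L, R⁆ X Y = ⁅(L : Module.End ℝ V), R X Y⁆ - R ((L : Module.End ℝ V) X) Y
      - R X ((L : Module.End ℝ V) Y) := by
  ext Z
  simp [LieHom.lie_apply, LieSubalgebra.coe_bracket_of_module, LieRing.of_associative_ring_bracket]
  abel

/-- The space of curvature tensors of type `A`: the `A`-valued two-forms on `V` that satisfy the
Bianchi identity. -/
def curv (A : LieSubalgebra ℝ (Module.End ℝ V)) : Submodule ℝ (Tens V) where
  carrier := {R | (∀ X, R X X = 0) ∧ (∀ X Y, R X Y ∈ A) ∧
    ∀ X Y Z, R X Y Z + R Y Z X + R Z X Y = 0}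
  add_mem' := by
    rintro R S ⟨h1, h2, h3⟩ ⟨k1, k2, k3⟩
    refine ⟨fun X => by simp [h1, k1], fun X Y => by simpa using A.add_mem (h2 X Y) (k2 X Y),
      fun X Y Z => ?_⟩
    have := congrArg₂ (· + ·) (h3 X Y Z) (k3 X Y Z)
    simp only [LinearMap.add_apply, add_zero] at this ⊢
    rw [← this]; abel
  zero_mem' := ⟨fun X => by simp, fun X Y => by simp, fun X Y Z => by simp⟩
  smul_mem' := by
    rintro c R ⟨h1, h2, h3⟩
    refine ⟨fun X => by simp [h1], fun X Y => by simpa using A.smul_mem c (h2 X Y),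
      fun X Y Z => ?_⟩
    simp only [LinearMap.smul_apply, ← smul_add, h3, smul_zero]

/-- The Ricci map `Ric(R)(Y, Z) = Tr (X ↦ R(X, Y)Z)`. -/
noncomputable def ric : Tens V →ₗ[ℝ] Bil V where
  toFun R := LinearMap.mk₂ ℝ (fun Y Z => LinearMap.trace ℝ V ((R.flip Y).flip Z))
    (fun Y Y' Z => by
      rw [map_add]
      exact map_add (LinearMap.trace ℝ V) ((R.flip Y).flip Z) ((R.flip Y').flip Z))
    (fun c Y Z => by
      rw [map_smul]
      exact map_smul (LinearMap.trace ℝ V) c ((R.flip Y).flip Z))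
    (fun _ _ _ => by rw [map_add, map_add])
    (fun _ _ _ => by rw [map_smul, map_smul])
  map_add' R S := by
    ext Y Z
    exact map_add (LinearMap.trace ℝ V) ((R.flip Y).flip Z) ((S.flip Y).flip Z)
  map_smul' c R := by
    ext Y Z
    exact map_smul (LinearMap.trace ℝ V) c ((R.flip Y).flip Z)

/-- `W`: the kernel of the Ricci map on the curvature tensors of type `aut(G)`. -/
noncomputable def weyl (G : LieSubalgebra ℝ (Module.End ℝ V)) : Submodule ℝ (Tens V) :=
  curv (autG G) ⊓ LinearMap.ker ric

/-- Symmetric bilinear forms. -/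
def symForms (V : Type*) [AddCommGroup V] [Module ℝ V] : Submodule ℝ (Bil V) where
  carrier := {B | ∀ X Y, B X Y = B Y X}
  add_mem' := fun {B C} hB hC X Y => by
    rw [LinearMap.add_apply, LinearMap.add_apply, LinearMap.add_apply, LinearMap.add_apply,
      hB X Y, hC X Y]
  zero_mem' := fun _ _ => rfl
  smul_mem' := fun c B hB X Y => by
    rw [LinearMap.smul_apply, LinearMap.smul_apply, LinearMap.smul_apply, LinearMap.smul_apply,
      hB X Y]

/-- Antisymmetric bilinear forms. -/
def skewForms (V : Type*) [AddCommGroup V] [Module ℝ V] : Submodule ℝ (Bil V) where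
  carrier := {B | ∀ X Y, B X Y = -B Y X}
  add_mem' := fun {B C} hB hC X Y => by
    rw [LinearMap.add_apply, LinearMap.add_apply, LinearMap.add_apply, LinearMap.add_apply,
      hB X Y, hC X Y, neg_add]
  zero_mem' := fun _ _ => by simp
  smul_mem' := fun c B hB X Y => by
    rw [LinearMap.smul_apply, LinearMap.smul_apply, LinearMap.smul_apply, LinearMap.smul_apply,
      hB X Y, smul_neg]

/-- `Bil_G(V)`: the bilinear forms that are hermitian with respect to `G`. -/
def hermForms (G : LieSubalgebra ℝ (Module.End ℝ V)) : Submodule ℝ (Bil V) where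
  carrier := {B | ∀ A ∈ G, ∀ X Y, B (A X) Y = -B X (A Y)}
  add_mem' := fun {B C} hB hC A hA X Y => by
    rw [LinearMap.add_apply, LinearMap.add_apply, LinearMap.add_apply, LinearMap.add_apply,
      hB A hA X Y, hC A hA X Y, neg_add]
  zero_mem' := fun _ _ _ _ => by simp
  smul_mem' := fun c B hB A hA X Y => by
    rw [LinearMap.smul_apply, LinearMap.smul_apply, LinearMap.smul_apply, LinearMap.smul_apply,
      hB A hA X Y, smul_neg]

/-- `Π(B)(X, Y) = ¼ (B(X, Y) + ∑ ε_α B(J_α X, J_α Y))`, the projector of `Bil(V)` onto `Bil_G(V)`. -/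
noncomputable def proj (J : Fin 3 → Module.End ℝ V) : Bil V →ₗ[ℝ] Bil V where
  toFun B := (1 / 4 : ℝ) • (B + ∑ a, eps a • B.compl₁₂ (J a) (J a))
  map_add' B C := by
    ext X Y
    simp [Fin.sum_univ_three]
    ring
  map_smul' c B := by
    ext X Y
    simp [Fin.sum_univ_three]
    ring

/-- The symmetric forms in `Bil_G(V)`. -/
def symHerm (G : LieSubalgebra ℝ (Module.End ℝ V)) : Submodule ℝ (Bil V) :=
  symForms V ⊓ hermForms G

/-- The antisymmetric forms in `Bil_G(V)`. -/
def skewHerm (G : LieSubalgebra ℝ (Module.End ℝ V)) : Submodule ℝ (Bil V) :=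
  skewForms V ⊓ hermForms G

/-- `S²_mix = (Id - Π)(S²)`. -/
noncomputable def symMix (J : Fin 3 → Module.End ℝ V) : Submodule ℝ (Bil V) :=
  (symForms V).map ((LinearMap.id : Bil V →ₗ[ℝ] Bil V) - proj J)

/-- `Λ²_mix = (Id - Π)(Λ²)`. -/
noncomputable def skewMix (J : Fin 3 → Module.End ℝ V) : Submodule ℝ (Bil V) :=
  (skewForms V).map ((LinearMap.id : Bil V →ₗ[ℝ] Bil V) - proj J)

/-- The endomorphism `R^B(X, Y)` of `V`. -/
noncomputable def rbEnd (J : Fin 3 → Module.End ℝ V) (B : Bil V) (X Y : V) : Module.End ℝ V :=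
  (B Y X - B X Y) • (1 : Module.End ℝ V) + (B Y).smulRight X - (B X).smulRight Y +
    ∑ a, eps a • ((B X (J a Y) - B Y (J a X)) • J a +
      ((B X).comp (J a)).smulRight (J a Y) - ((B Y).comp (J a)).smulRight (J a X))

/-- The formula for `R^B(X, Y)Z`. -/
theorem rbEnd_apply (J : Fin 3 → Module.End ℝ V) (B : Bil V) (X Y Z : V) :
    rbEnd J B X Y Z = (B Y X - B X Y) • Z + B Y Z • X - B X Z • Y +
      ∑ a, eps a • ((B X (J a Y) - B Y (J a X)) • J a Z +
        B X (J a Z) • J a Y - B Y (J a Z) • J a X) := by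
  simp [rbEnd, Fin.sum_univ_three]

/-- The map `φ : B ↦ R^B`. -/
noncomputable def phi (J : Fin 3 → Module.End ℝ V) : Bil V →ₗ[ℝ] Tens V where
  toFun B := LinearMap.mk₂ ℝ (rbEnd J B)
    (fun X X' Y => by
      ext Z; simp only [rbEnd_apply, Fin.sum_univ_three, LinearMap.add_apply, map_add]; module)
    (fun c X Y => by
      ext Z
      simp only [rbEnd_apply, Fin.sum_univ_three, LinearMap.smul_apply, map_smul, smul_eq_mul]
      module)
    (fun X Y Y' => by
      ext Z; simp only [rbEnd_apply, Fin.sum_univ_three, LinearMap.add_apply, map_add]; module)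
    (fun c X Y => by
      ext Z
      simp only [rbEnd_apply, Fin.sum_univ_three, LinearMap.smul_apply, map_smul, smul_eq_mul]
      module)
  map_add' B C := by
    ext X Y Z
    simp only [LinearMap.mk₂_apply, rbEnd_apply, Fin.sum_univ_three, LinearMap.add_apply]
    module
  map_smul' c B := by
    ext X Y Z
    simp only [LinearMap.mk₂_apply, rbEnd_apply, Fin.sum_univ_three, LinearMap.smul_apply,
      smul_eq_mul, RingHom.id_apply]
    module

/-- `R(S²_h) = φ(S²_G)`. -/
noncomputable def rSymHerm (G : LieSubalgebra ℝ (Module.End ℝ V)) (J : Fin 3 → Module.End ℝ V) :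
    Submodule ℝ (Tens V) :=
  (symHerm G).map (phi J)

/-- `R(S²_mix) = φ(S²_mix)`. -/
noncomputable def rSymMix (J : Fin 3 → Module.End ℝ V) : Submodule ℝ (Tens V) :=
  (symMix J).map (phi J)

/-- `R(Λ²_h) = φ(Λ²_G)`. -/
noncomputable def rSkewHerm (G : LieSubalgebra ℝ (Module.End ℝ V)) (J : Fin 3 → Module.End ℝ V) :
    Submodule ℝ (Tens V) :=
  (skewHerm G).map (phi J)

/-- `R(Λ²_mix) = φ(Λ²_mix)`. -/
noncomputable def rSkewMix (J : Fin 3 → Module.End ℝ V) : Submodule ℝ (Tens V) :=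
  (skewMix J).map (phi J)

/-- `N` is the direct sum of the subspaces `p i`. -/
def IsDirectSum {ι M : Type*} [AddCommMonoid M] [Module ℝ M] (p : ι → Submodule ℝ M)
    (N : Submodule ℝ M) : Prop :=
  iSupIndep p ∧ iSup p = N

/-- The subspace `p` is invariant under the action of the Lie algebra `A` and is an irreducible
`A`-module (in particular nonzero). -/
def IsIrredSubmodule (A : LieSubalgebra ℝ (Module.End ℝ V)) (p : Submodule ℝ (Tens V)) : Prop :=
  ∃ N : LieSubmodule ℝ A (Tens V), N.toSubmodule = p ∧ LieModule.IsIrreducible ℝ A N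

/-- In dimension four: `G'` is a para-quaternionic structure with `[G, G'] = 0` and
`aut(G) = ℝ Id ⊕ G ⊕ G'`. -/
structure IsDual (G G' : LieSubalgebra ℝ (Module.End ℝ V)) : Prop where
  paraquaternionic : IsParaquaternionic G'
  commute : ∀ A ∈ G, ∀ B ∈ G', ⁅A, B⁆ = 0
  decomp : IsDirectSum (M := Module.End ℝ V)
    ![Submodule.span ℝ {(1 : Module.End ℝ V)}, G.toSubmodule, G'.toSubmodule]
    (autG G).toSubmodule

end ParaQuaternion

namespace ParaQuaternion

variable {V : Type*} [AddCommGroup V] [Module ℝ V]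

/-! ### Lie submodules and direct sums -/

/-! Write N = dim V. Along the eigenspaces of `J 1` the space V becomes E ⊗ ℝ², dim E = 2n, with the
`J a` acting on ℝ² as the standard basis of sl(2). Then aut(H) = gl(E) ⊗ 1, aut(G) = gl(E) ⊗ 1 + 1 ⊗
sl(2), and the theorem becomes a statement about tensors on E.

Ricci part. The map B ↦ Ric(R^B) is multiplication by N + 8 on S²_G, by N on S²_mix and by N + 4 on
Λ², so it is bijective on Bil(V) and the kernel W of Ric is a complement of the image of `phi`
(`ric_phi_injective`, `curv_autG_isDirectSum`). A hermitian form is g ⊗ ω with ω the skew form of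
ℝ²; a mixed form is symmetric in its ℝ² indices. Rank one operators on E and matrix units on ℝ²
carry any nonzero form of a given type to any other, which makes the four images of `phi`
irreducible (`Splitting.herm_minimal`, `Splitting.mix_minimal`).

Weyl part. By the Bianchi identity an aut(H)-valued curvature tensor is ω ⊗ T with T : E³ → E
symmetric, and it is Ricci-flat exactly when T is traceless. Let A = α ⊗ e with α(e) = 0. The fourth
power of the action of A sends T to a multiple of α³ ⊗ e with factor proportional to α(T(e, e, e)).
Some such factor is nonzero unless T = 0 (`eq_zero_of_traceless`), so a nonzero invariant subspace
contains one of these pure tensors, hence all of them. An inner product for which the action is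
closed under transposition gives invariant complements, and two complementary invariant subspaces
cannot both contain the pure tensors (`weylH_isMinimal`).

Comparison of W with its aut(H)-valued part. The coefficients `omega` of the `J a` in a Ricci-flat
tensor satisfy a linear system with parameter N/2. For N > 4 it has only the zero solution, so W is
aut(H)-valued (`weyl_eq_weylH`). For N = 4 the system says that the G-component is itself a
curvature tensor (`gPart_mem_curv`). What remains takes values in the traceless part of aut(H),
which is G', and the two summands are handled alike because G and G' play symmetric roles. -/

theorem lie_tens_apply (L : Module.End ℝ V) (R : Tens V) (X Y Z : V) :
    ⁅L, R⁆ X Y Z = L (R X Y Z) - R X Y (L Z) - R (L X) Y Z - R X (L Y) Z := by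
  simp [LieHom.lie_apply, LieRing.of_associative_ring_bracket]
  abel

/-- `p` is stable under the action of `A`. -/
def Invariant (A : LieSubalgebra ℝ (Module.End ℝ V)) (p : Submodule ℝ (Tens V)) : Prop :=
  ∀ L ∈ A, ∀ R ∈ p, ⁅L, R⁆ ∈ p

/-- `p` is nonzero and every nonzero `A`-stable subspace of `p` is `p`. -/
structure IsMinimal (A : LieSubalgebra ℝ (Module.End ℝ V)) (p : Submodule ℝ (Tens V)) : Prop where
  ne_bot : p ≠ ⊥
  le_of : ∀ q ≤ p, Invariant A q → q ≠ ⊥ → p ≤ q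

theorem Invariant.mono {A A' : LieSubalgebra ℝ (Module.End ℝ V)} {p : Submodule ℝ (Tens V)}
    (h : A ≤ A') (hp : Invariant A' p) : Invariant A p := fun L hL => hp L (h hL)

/-- A larger algebra has fewer stable subspaces, so minimality established over aut(H) serves for
aut(G) too. -/
theorem IsMinimal.mono {A A' : LieSubalgebra ℝ (Module.End ℝ V)} {p : Submodule ℝ (Tens V)}
    (h : A ≤ A') (hp : IsMinimal A p) : IsMinimal A' p :=
  ⟨hp.ne_bot, fun q hq hi => hp.le_of q hq (hi.mono h)⟩

theorem IsMinimal.isIrredSubmodule {A : LieSubalgebra ℝ (Module.End ℝ V)}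
    {p : Submodule ℝ (Tens V)} (hm : IsMinimal A p) (hi : Invariant A p) :
    IsIrredSubmodule A p := by
  let N : LieSubmodule ℝ A (Tens V) :=
    { p with lie_mem := fun {L R} hR => hi L L.2 R hR }
  refine ⟨N, rfl, ?_⟩
  have hN : ∀ x : N, (x : Tens V) ∈ p := fun x => x.2
  have hnt : Nontrivial (LieSubmodule ℝ A N) := by
    obtain ⟨x, hx, h0⟩ := (Submodule.ne_bot_iff p).1 hm.ne_bot
    refine ⟨⊥, ⊤, fun h => h0 ?_⟩
    have : (⟨x, hx⟩ : N) ∈ (⊤ : LieSubmodule ℝ A N) := LieSubmodule.mem_top _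
    rw [← h, LieSubmodule.mem_bot] at this
    exact congrArg Subtype.val this
  refine { hnt with eq_bot_or_eq_top := fun K => ?_ }
  by_cases hK : K = ⊥
  · exact Or.inl hK
  right
  have hle : K.toSubmodule.map p.subtype ≤ p := Submodule.map_subtype_le _ _
  have h := hm.le_of (K.toSubmodule.map p.subtype) hle ?_ ?_
  · rw [eq_top_iff]
    intro x _
    obtain ⟨y, hy, hyx⟩ := h (hN x)
    have : y = x := Subtype.ext hyx
    exact this ▸ hy
  · rintro L hL _ ⟨x, hx, rfl⟩
    have := K.lie_mem (x := (⟨L, hL⟩ : A)) (m := (show N from x)) hx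
    exact ⟨_, this, rfl⟩
  · intro h0
    apply hK
    rw [LieSubmodule.eq_bot_iff]
    intro x hx
    have : (x : Tens V) ∈ K.toSubmodule.map p.subtype := ⟨x, hx, rfl⟩
    rw [h0, Submodule.mem_bot] at this
    exact Subtype.ext this

theorem isDirectSum_of {k : ℕ} {M : Type*} [AddCommGroup M] [Module ℝ M]
    (p : Fin k → Submodule ℝ M) (N : Submodule ℝ M) (h1 : ∀ i, p i ≤ N)
    (h2 : ∀ x ∈ N, ∃ f : Fin k → M, (∀ i, f i ∈ p i) ∧ ∑ i, f i = x)
    (h3 : ∀ f : Fin k → M, (∀ i, f i ∈ p i) → ∑ i, f i = 0 → ∀ i, f i = 0) :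
    IsDirectSum p N := by
  constructor
  · rw [iSupIndep_iff_finsetSum_eq_zero_imp_eq_zero]
    intro t v hv h0 i hi
    have h := h3 (fun j => if j ∈ t then v j else 0) (fun j => by
      by_cases hj : j ∈ t
      · simpa [hj] using hv j hj
      · simp [hj]) (by simpa [Finset.sum_ite_mem] using h0) i
    simpa [hi] using h
  · refine le_antisymm (iSup_le h1) fun x hx => ?_
    obtain ⟨f, hf, rfl⟩ := h2 x hx
    exact Submodule.sum_mem _ fun i _ => Submodule.mem_iSup_of_mem i (hf i)

theorem isDirectSum_pair {M : Type*} [AddCommGroup M] [Module ℝ M]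
    {p₀ p₁ N : Submodule ℝ M} (h0 : p₀ ≤ N) (h1 : p₁ ≤ N)
    (h2 : ∀ x ∈ N, ∃ y ∈ p₁, x - y ∈ p₀) (h3 : ∀ x ∈ p₀, x ∈ p₁ → x = 0) :
    IsDirectSum ![p₀, p₁] N := by
  refine isDirectSum_of _ _ (by simp [Fin.forall_fin_two, h0, h1]) (fun x hx => ?_)
    (fun f hf hs => ?_)
  · obtain ⟨y, hy, hxy⟩ := h2 x hx
    exact ⟨![x - y, y], by simp [Fin.forall_fin_two, hy, hxy], by simp⟩
  · simp only [Fin.forall_fin_two, Matrix.cons_val_zero, Matrix.cons_val_one,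
      Fin.sum_univ_two] at hf hs ⊢
    have h : f 0 = 0 := h3 _ hf.1 (by
      rw [eq_neg_of_add_eq_zero_left hs]; exact neg_mem hf.2)
    exact ⟨h, by simpa [h] using hs⟩

theorem IsDirectSum.exists_pair {M : Type*} [AddCommGroup M] [Module ℝ M]
    {p₀ p₁ p₂ N : Submodule ℝ M} (h : IsDirectSum ![p₀, p₁, p₂] N) {x : M} (hx : x ∈ N) :
    ∃ a ∈ p₀, ∃ b ∈ p₁, ∃ c ∈ p₂, a + b + c = x := by
  rw [← h.2, iSup_fin_three] at hx
  simp only [Matrix.cons_val_zero, Matrix.cons_val_one, Matrix.cons_val_two, Matrix.tail_cons,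
    Matrix.head_cons, Submodule.mem_sup] at hx
  obtain ⟨y, ⟨a, ha, b, hb, rfl⟩, c, hc, rfl⟩ := hx
  exact ⟨a, ha, b, hb, c, hc, rfl⟩

/-! ### Algebra of a para-hypercomplex structure -/

section Algebra

variable {J : Fin 3 → Module.End ℝ V}

@[simp] theorem eps_zero : eps 0 = 1 := rfl
@[simp] theorem eps_one : eps 1 = -1 := rfl
@[simp] theorem eps_two : eps 2 = -1 := rfl

namespace IsParahypercomplex

variable (h : IsParahypercomplex J)
include h

theorem J00 (x : V) : J 0 (J 0 x) = -x := by simpa using LinearMap.congr_fun (h.sq 0) x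
theorem J11 (x : V) : J 1 (J 1 x) = x := by simpa using LinearMap.congr_fun (h.sq 1) x
theorem J22 (x : V) : J 2 (J 2 x) = x := by simpa using LinearMap.congr_fun (h.sq 2) x
theorem J12 (x : V) : J 1 (J 2 x) = -J 0 x := by simpa using LinearMap.congr_fun (h.mul 0) x
theorem J20 (x : V) : J 2 (J 0 x) = J 1 x := by simpa using LinearMap.congr_fun (h.mul 1) x
theorem J01 (x : V) : J 0 (J 1 x) = J 2 x := by simpa using LinearMap.congr_fun (h.mul 2) x
theorem J21 (x : V) : J 2 (J 1 x) = J 0 x := by rw [← h.J01, h.J11]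
theorem J02 (x : V) : J 0 (J 2 x) = -J 1 x := by rw [← h.J01, h.J00]
theorem J10 (x : V) : J 1 (J 0 x) = -J 2 x := by rw [← h.J21, h.J12, h.J01]

end IsParahypercomplex

theorem mem_autH {L : Module.End ℝ V} : L ∈ autH J ↔ ∀ a x, L (J a x) = J a (L x) := by
  change (∀ a, ⁅L, J a⁆ = 0) ↔ _
  simp only [LieRing.of_associative_ring_bracket, sub_eq_zero, LinearMap.ext_iff,
    Module.End.mul_apply]

theorem one_mem_autH : (1 : Module.End ℝ V) ∈ autH J := mem_autH.2 fun _ _ => rfl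

theorem mul_mem_autH {A B : Module.End ℝ V} (hA : A ∈ autH J) (hB : B ∈ autH J) :
    A * B ∈ autH J := mem_autH.2 fun a x => by
  rw [Module.End.mul_apply, mem_autH.1 hB, mem_autH.1 hA, Module.End.mul_apply]

/-- Each `J a` is a product b c of anticommuting elements with c commuting with A. Cyclicity gives
tr(bcA) = tr(cAb) = tr(Acb) = tr(cbA) = -tr(bcA). -/
theorem IsParahypercomplex.trace_mul (h : IsParahypercomplex J)
    {A : Module.End ℝ V} (hA : A ∈ autH J) (a : Fin 3) : LinearMap.trace ℝ V (J a * A) = 0 := by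
  have key : ∀ b c : Module.End ℝ V, (∀ x, c (A x) = A (c x)) → (∀ x, b (c x) = -c (b x)) →
      LinearMap.trace ℝ V (b * c * A) = 0 := by
    intro b c h1 h2
    have e1 : LinearMap.trace ℝ V (b * c * A) = LinearMap.trace ℝ V (c * A * b) := by
      rw [mul_assoc, LinearMap.trace_mul_comm]
    have e2 : LinearMap.trace ℝ V (c * A * b) = LinearMap.trace ℝ V (A * c * b) := by
      congr 1; ext x; simp [h1]
    have e3 : LinearMap.trace ℝ V (A * c * b) = LinearMap.trace ℝ V (c * b * A) := by
      rw [mul_assoc, LinearMap.trace_mul_comm]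
    have e4 : c * b * A = -(b * c * A) := by
      ext x; simp [h2]
    rw [e4, map_neg] at e3
    linarith
  have hA' := fun a x => (mem_autH.1 hA a x).symm
  fin_cases a
  · have := key (J 2) (J 1) (hA' 1) (fun x => by rw [h.J21, h.J12, neg_neg])
    rwa [show J 2 * J 1 = J 0 from LinearMap.ext h.J21] at this
  · have := key (J 2) (J 0) (hA' 0) (fun x => by rw [h.J20, h.J02, neg_neg])
    rwa [show J 2 * J 0 = J 1 from LinearMap.ext h.J20] at this
  · have := key (J 0) (J 1) (hA' 1) (fun x => by rw [h.J01, h.J10, neg_neg])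
    rwa [show J 0 * J 1 = J 2 from LinearMap.ext h.J01] at this

theorem IsParahypercomplex.trace_eq_zero (h : IsParahypercomplex J) (a : Fin 3) :
    LinearMap.trace ℝ V (J a) = 0 := by
  simpa using h.trace_mul one_mem_autH a

/-- Pairing with `J a` recovers the coefficients of an element of `aut(H) + span J`. -/
theorem IsParahypercomplex.trace_mul_add [FiniteDimensional ℝ V] (h : IsParahypercomplex J)
    {A : Module.End ℝ V} (hA : A ∈ autH J) (c : Fin 3 → ℝ) (a : Fin 3) :
    LinearMap.trace ℝ V (J a * (A + ∑ b, c b • J b)) =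
      -(eps a * Module.finrank ℝ V * c a) := by
  have t := h.trace_eq_zero
  rw [mul_add, map_add, h.trace_mul hA, Finset.mul_sum, map_sum, zero_add]
  have hm : ∀ b, J a * c b • J b = c b • (J a * J b) := fun b => by rw [mul_smul_comm]
  simp only [hm, map_smul, Fin.sum_univ_three]
  have e00 : J 0 * J 0 = -1 := by ext x; simp [h.J00]
  have e11 : J 1 * J 1 = 1 := by ext x; simp [h.J11]
  have e22 : J 2 * J 2 = 1 := by ext x; simp [h.J22]
  have e01 : J 0 * J 1 = J 2 := by ext x; simp [h.J01]
  have e02 : J 0 * J 2 = -J 1 := by ext x; simp [h.J02]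
  have e10 : J 1 * J 0 = -J 2 := by ext x; simp [h.J10]
  have e12 : J 1 * J 2 = -J 0 := by ext x; simp [h.J12]
  have e20 : J 2 * J 0 = J 1 := by ext x; simp [h.J20]
  have e21 : J 2 * J 1 = J 0 := by ext x; simp [h.J21]
  fin_cases a
  · simp [e00, e01, e02, t]; ring
  · simp [e10, e11, e12, t]; ring
  · simp [e20, e21, e22, t]; ring

theorem IsParahypercomplex.coeff_eq_zero [FiniteDimensional ℝ V] [Nontrivial V]
    (h : IsParahypercomplex J)
    {A : Module.End ℝ V} (hA : A ∈ autH J) {c : Fin 3 → ℝ} (h0 : A + ∑ b, c b • J b = 0) :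
    c = 0 ∧ A = 0 := by
  have hc : c = 0 := by
    ext a
    have := h.trace_mul_add hA c a
    have hd : (Module.finrank ℝ V : ℝ) ≠ 0 := by
      exact_mod_cast Module.finrank_pos.ne'
    have he : eps a ≠ 0 := by fin_cases a <;> simp
    rw [h0, mul_zero, map_zero, eq_comm, neg_eq_zero] at this
    simpa [hd, he] using this
  subst hc
  exact ⟨rfl, by simpa using h0⟩

theorem IsParahypercomplex.linearIndependent [FiniteDimensional ℝ V] [Nontrivial V]
    (h : IsParahypercomplex J) : LinearIndependent ℝ J := by
  rw [Fintype.linearIndependent_iff]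
  intro c hc
  exact fun i => congrFun (h.coeff_eq_zero (autH J).zero_mem (by simpa using hc)).1 i

end Algebra

/-! ### The normalizer of a para-quaternionic structure. -/

section Corresponds

variable {G : LieSubalgebra ℝ (Module.End ℝ V)} {J : Fin 3 → Module.End ℝ V}

theorem Corresponds.mem_iff (h : Corresponds G J) {L : Module.End ℝ V} :
    L ∈ G ↔ ∃ c : Fin 3 → ℝ, ∑ a, c a • J a = L := by
  rw [← LieSubalgebra.mem_toSubmodule, ← h.span_eq, Submodule.mem_span_range_iff_exists_fun]

theorem Corresponds.J_mem (h : Corresponds G J) (a : Fin 3) : J a ∈ G := by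
  rw [← LieSubalgebra.mem_toSubmodule, ← h.span_eq]
  exact Submodule.subset_span ⟨a, rfl⟩

theorem Corresponds.nontrivial (h : Corresponds G J) : Nontrivial V := by
  by_contra hV
  rw [not_nontrivial_iff_subsingleton] at hV
  exact h.linearIndependent.ne_zero 0 (Subsingleton.elim _ _)

theorem Corresponds.mem_autG_of (h : Corresponds G J) {L : Module.End ℝ V} {p q s : ℝ}
    (h0 : ∀ x, L (J 0 x) = J 0 (L x) + p • J 1 x + q • J 2 x)
    (h1 : ∀ x, L (J 1 x) = J 1 (L x) + p • J 0 x + s • J 2 x)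
    (h2 : ∀ x, L (J 2 x) = J 2 (L x) + q • J 0 x - s • J 1 x) : L ∈ autG G := by
  rw [mem_autG]
  intro A hA
  obtain ⟨c, rfl⟩ := h.mem_iff.1 hA
  rw [h.mem_iff]
  refine ⟨![c 1 * p + c 2 * q, c 0 * p - c 2 * s, c 0 * q + c 1 * s], ?_⟩
  ext x
  simp only [Fin.sum_univ_three, LieRing.of_associative_ring_bracket, LinearMap.add_apply,
    LinearMap.sub_apply, Module.End.mul_apply, LinearMap.smul_apply, map_add, map_smul, h0, h1, h2,
    Matrix.cons_val]
  module

/-- The commutator with L is a derivation respecting the products of the `J a`, so its matrix on G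
lies in a copy of so(1,2) and has three free parameters. -/
theorem Corresponds.autG_spec [FiniteDimensional ℝ V] (h : Corresponds G J)
    {L : Module.End ℝ V} (hL : L ∈ autG G) : ∃ p q s : ℝ,
    (∀ x, L (J 0 x) = J 0 (L x) + p • J 1 x + q • J 2 x) ∧
    (∀ x, L (J 1 x) = J 1 (L x) + p • J 0 x + s • J 2 x) ∧
    (∀ x, L (J 2 x) = J 2 (L x) + q • J 0 x - s • J 1 x) := by
  have := h.nontrivial
  have hp := h.parahypercomplex
  rw [mem_autG] at hL
  have hJ : ∀ a, ∃ c : Fin 3 → ℝ, ∀ x, L (J a x) = J a (L x) + c 0 • J 0 x + c 1 • J 1 x +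
      c 2 • J 2 x := by
    intro a
    obtain ⟨c, hc⟩ := h.mem_iff.1 (hL _ (h.J_mem a))
    refine ⟨c, fun x => ?_⟩
    have := LinearMap.congr_fun hc x
    simp only [Fin.sum_univ_three, LieRing.of_associative_ring_bracket, LinearMap.add_apply,
      LinearMap.sub_apply, Module.End.mul_apply, LinearMap.smul_apply] at this
    rw [add_assoc, add_assoc, ← add_assoc (c 0 • J 0 x), this]
    abel
  obtain ⟨c, hc⟩ := hJ 0
  obtain ⟨d, hd⟩ := hJ 1
  obtain ⟨e, he⟩ := hJ 2
  have indep : ∀ t u v w : ℝ, (∀ x : V, t • x + u • J 0 x + v • J 1 x + w • J 2 x = 0) →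
      t = 0 ∧ u = 0 ∧ v = 0 ∧ w = 0 := by
    intro t u v w hx
    have := hp.coeff_eq_zero ((autH J).smul_mem t one_mem_autH) (c := ![u, v, w])
      (by ext x; simpa [Fin.sum_univ_three, add_assoc] using hx x)
    have h0 := congrFun this.1 0
    have h1 := congrFun this.1 1
    have h2 := congrFun this.1 2
    have ht := (smul_eq_zero.1 this.2).resolve_right one_ne_zero
    simp at h0 h1 h2
    exact ⟨ht, h0, h1, h2⟩
  -- Three product relations are differentiated: J 0 squared, J 1 squared, and J 0 J 1 = J 2. The
  -- third one determines `e` from `c` and `d`.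
  have k0 := indep (-2 * c 0) 0 0 0 (fun x => by
    have := hc (J 0 x)
    rw [hp.J00, hc, map_neg, map_add, map_add, map_add, map_smul, map_smul, map_smul,
      hp.J00, hp.J00, hp.J10, hp.J20, hp.J01, hp.J02] at this
    linear_combination (norm := module) -this)
  have k1 := indep (2 * d 1) 0 0 0 (fun x => by
    have := hd (J 1 x)
    rw [hp.J11, hd, map_add, map_add, map_add, map_smul, map_smul, map_smul,
      hp.J11, hp.J11, hp.J01, hp.J21, hp.J10, hp.J12] at this
    linear_combination (norm := module) -this)
  have k2 := indep (c 1 - d 0) (c 2 - e 0) (-e 1 - d 2) (c 0 + d 1 - e 2) (fun x => by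
    have := he x
    rw [← hp.J01, hc, hd, map_add, map_add, map_add, map_smul, map_smul, map_smul,
      hp.J01, hp.J11, hp.J21, hp.J00, hp.J02] at this
    simp only [hp.J01] at this
    linear_combination (norm := module) this)
  obtain ⟨a1, a2, a3, a4⟩ := k2
  have c0 : c 0 = 0 := by linarith [k0.1]
  have d1 : d 1 = 0 := by linarith [k1.1]
  refine ⟨c 1, c 2, d 2, fun x => ?_, fun x => ?_, fun x => ?_⟩
  · rw [hc, c0]; module
  · rw [hd, d1, show d 0 = c 1 by linarith]; module
  · rw [he, show e 0 = c 2 by linarith, show e 1 = -d 2 by linarith, show e 2 = 0 by linarith]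
    module

theorem Corresponds.autG_decomp [FiniteDimensional ℝ V] (h : Corresponds G J)
    {L : Module.End ℝ V} (hL : L ∈ autG G) :
    ∃ A ∈ autH J, ∃ c : Fin 3 → ℝ, L = A + ∑ a, c a • J a := by
  obtain ⟨p, q, s, h0, h1, h2⟩ := h.autG_spec hL
  have hp := h.parahypercomplex
  -- The derivation is inner: these coefficients are read off from the commutators [J 0, J 1] = 2 J
  -- 2, [J 2, J 0] = 2 J 1 and [J 2, J 1] = 2 J 0.
  refine ⟨L - ∑ a, (![s / 2, -(q / 2), p / 2] : Fin 3 → ℝ) a • J a, ?_, _, (sub_add_cancel _ _).symm⟩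
  rw [mem_autH]
  intro a x
  fin_cases a
  · simp [Fin.sum_univ_three, h0, hp.J00, hp.J10, hp.J20, hp.J01, hp.J02]; module
  · simp [Fin.sum_univ_three, h1, hp.J01, hp.J11, hp.J21, hp.J10, hp.J12]; module
  · simp [Fin.sum_univ_three, h2, hp.J02, hp.J12, hp.J22, hp.J20, hp.J21]; module

theorem Corresponds.autH_le (h : Corresponds G J) : autH J ≤ autG G := fun L hL =>
  h.mem_autG_of (p := 0) (q := 0) (s := 0) (by simp [mem_autH.1 hL]) (by simp [mem_autH.1 hL])
    (by simp [mem_autH.1 hL])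

theorem le_autG : G ≤ autG G := LieSubalgebra.le_normalizer G

theorem Corresponds.mem_autG_iff [FiniteDimensional ℝ V] (h : Corresponds G J)
    {L : Module.End ℝ V} :
    L ∈ autG G ↔ ∃ A ∈ autH J, ∃ c : Fin 3 → ℝ, L = A + ∑ a, c a • J a := by
  refine ⟨h.autG_decomp, ?_⟩
  rintro ⟨A, hA, c, rfl⟩
  exact (autG G).add_mem (h.autH_le hA) (le_autG (h.mem_iff.2 ⟨c, rfl⟩))

end Corresponds

/-! ### The curvature tensors `R^B` -/

theorem phi_apply (J : Fin 3 → Module.End ℝ V) (B : Bil V) (X Y Z : V) :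
    phi J B X Y Z = (B Y X - B X Y) • Z + B Y Z • X - B X Z • Y +
      ((B X (J 0 Y) - B Y (J 0 X)) • J 0 Z + B X (J 0 Z) • J 0 Y - B Y (J 0 Z) • J 0 X) -
      ((B X (J 1 Y) - B Y (J 1 X)) • J 1 Z + B X (J 1 Z) • J 1 Y - B Y (J 1 Z) • J 1 X) -
      ((B X (J 2 Y) - B Y (J 2 X)) • J 2 Z + B X (J 2 Z) • J 2 Y - B Y (J 2 Z) • J 2 X) := by
  change rbEnd J B X Y Z = _
  rw [rbEnd_apply, Fin.sum_univ_three, eps_zero, eps_one, eps_two]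
  module

theorem proj_apply (J : Fin 3 → Module.End ℝ V) (B : Bil V) (X Y : V) :
    proj J B X Y = (B X Y + B (J 0 X) (J 0 Y) - B (J 1 X) (J 1 Y) - B (J 2 X) (J 2 Y)) / 4 := by
  simp [proj, Fin.sum_univ_three]
  ring

theorem ric_apply (R : Tens V) (Y Z : V) :
    ric R Y Z = LinearMap.trace ℝ V ((R.flip Y).flip Z) := rfl

/-- The action of an endomorphism on bilinear forms. -/
def formAct (L : Module.End ℝ V) (B : Bil V) : Bil V := -B.comp L - B.compl₂ L

theorem formAct_apply (L : Module.End ℝ V) (B : Bil V) (X Y : V) :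
    formAct L B X Y = -B (L X) Y - B X (L Y) := by
  simp [formAct]

section

variable {G : LieSubalgebra ℝ (Module.End ℝ V)} {J : Fin 3 → Module.End ℝ V}

/-- Equivariance of `phi`: the tensor ∑ ε_a J_a ⊗ J_a entering R^B is annihilated by the commutator
with L, so the terms in p, q and s cancel. -/
theorem phi_formAct [FiniteDimensional ℝ V] (h : Corresponds G J) {L : Module.End ℝ V}
    (hL : L ∈ autG G) (B : Bil V) : phi J (formAct L B) = ⁅L, phi J B⁆ := by
  obtain ⟨p, q, s, h0, h1, h2⟩ := h.autG_spec hL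
  ext X Y Z
  rw [lie_tens_apply]
  simp only [phi_apply, formAct_apply, h0, h1, h2, map_add, map_sub, map_smul, smul_eq_mul]
  module

/-- The rank one operator `η ⊗ v`, averaged over the para-hypercomplex structure, commutes with it. -/
theorem IsParahypercomplex.average_mem (h : IsParahypercomplex J) (v : V) (η : V →ₗ[ℝ] ℝ) :
    η.smulRight v + (η ∘ₗ J 1).smulRight (J 1 v) + (η ∘ₗ J 2).smulRight (J 2 v)
      - (η ∘ₗ J 0).smulRight (J 0 v) ∈ autH J := by
  rw [mem_autH]
  intro a x
  fin_cases a
  · simp [h.J00, h.J10, h.J20, h.J01, h.J02]; module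
  · simp [h.J10, h.J11, h.J21, h.J01, h.J12]; module
  · simp [h.J20, h.J12, h.J22, h.J21, h.J02]; module

/-- Sorts R^B(X, Y) into a multiple of the identity, two averaged rank one operators lying in
aut(H), and a combination of the `J a`. This shows at once that its values lie in aut(G). -/
theorem phi_eq (B : Bil V) (X Y : V) : phi J B X Y = (B Y X - B X Y) • 1 +
    (((B Y).smulRight X + (B Y ∘ₗ J 1).smulRight (J 1 X) + (B Y ∘ₗ J 2).smulRight (J 2 X)
      - (B Y ∘ₗ J 0).smulRight (J 0 X)) - ((B X).smulRight Y + (B X ∘ₗ J 1).smulRight (J 1 Y) +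
      (B X ∘ₗ J 2).smulRight (J 2 Y) - (B X ∘ₗ J 0).smulRight (J 0 Y))) +
    ∑ a, (eps a * (B X (J a Y) - B Y (J a X))) • J a := by
  ext Z
  simp only [phi_apply, Fin.sum_univ_three, LinearMap.add_apply, LinearMap.sub_apply,
    LinearMap.smul_apply, LinearMap.smulRight_apply, LinearMap.comp_apply, Module.End.one_apply,
    eps_zero, eps_one, eps_two]
  module

theorem phi_mem_curv [FiniteDimensional ℝ V] (h : Corresponds G J) (B : Bil V) :
    phi J B ∈ curv (autG G) := by
  refine ⟨fun X => ?_, fun X Y => ?_, fun X Y Z => ?_⟩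
  · ext Z
    rw [phi_apply, LinearMap.zero_apply]
    module
  · rw [h.mem_autG_iff]
    exact ⟨_, add_mem ((autH J).smul_mem _ one_mem_autH)
      (sub_mem (h.parahypercomplex.average_mem _ _) (h.parahypercomplex.average_mem _ _)), _,
      phi_eq B X Y⟩
  · simp only [phi_apply]
    module

theorem phi_mem_curv_autH (h : Corresponds G J) {B : Bil V} (hB : B ∈ skewHerm G) :
    phi J B ∈ curv (autH J) := by
  -- For skew hermitian B the form B(X, J_a Y) is symmetric, so the G-component in `phi_eq`
  -- vanishes.
  have h0 : ∀ (a : Fin 3) (X Y : V), B X (J a Y) - B Y (J a X) = 0 := fun a X Y => by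
    have e1 : B Y (J a X) = -B (J a X) Y := hB.1 Y (J a X)
    have e2 : B (J a X) Y = -B X (J a Y) := hB.2 _ (h.J_mem a) X Y
    linarith
  refine ⟨fun X => ?_, fun X Y => ?_, fun X Y Z => ?_⟩
  · ext Z
    rw [phi_apply, LinearMap.zero_apply]
    module
  · rw [phi_eq]
    simp only [h0, mul_zero, zero_smul, Finset.sum_const_zero, add_zero]
    exact add_mem ((autH J).smul_mem _ one_mem_autH)
      (sub_mem (h.parahypercomplex.average_mem _ _) (h.parahypercomplex.average_mem _ _))
  · simp only [phi_apply]
    module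

/-! ### Ricci contraction of R^B and the splitting of the curvature space. -/

theorem ric_phi [FiniteDimensional ℝ V] (h : IsParahypercomplex J) (B : Bil V) (Y Z : V) :
    ric (phi J B) Y Z = (Module.finrank ℝ V + 2) * B Y Z - 2 * B Z Y +
      4 * (proj J B Y Z + proj J B Z Y) := by
  have e : ((phi J B).flip Y).flip Z =
      (B Y).smulRight Z - (B.flip Y).smulRight Z + B Y Z • (1 : Module.End ℝ V)
        - (B.flip Z).smulRight Y
      + ((B.flip (J 0 Y)).smulRight (J 0 Z) - (B Y ∘ₗ J 0).smulRight (J 0 Z)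
        + (B.flip (J 0 Z)).smulRight (J 0 Y) - B Y (J 0 Z) • J 0)
      - ((B.flip (J 1 Y)).smulRight (J 1 Z) - (B Y ∘ₗ J 1).smulRight (J 1 Z)
        + (B.flip (J 1 Z)).smulRight (J 1 Y) - B Y (J 1 Z) • J 1)
      - ((B.flip (J 2 Y)).smulRight (J 2 Z) - (B Y ∘ₗ J 2).smulRight (J 2 Z)
        + (B.flip (J 2 Z)).smulRight (J 2 Y) - B Y (J 2 Z) • J 2) := by
    ext X
    simp only [LinearMap.flip_apply, phi_apply, LinearMap.add_apply, LinearMap.sub_apply,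
      LinearMap.smul_apply, LinearMap.smulRight_apply, LinearMap.comp_apply,
      Module.End.one_apply]
    module
  rw [ric_apply, e]
  simp only [map_add, map_sub, map_smul, LinearMap.trace_smulRight, LinearMap.flip_apply,
    h.trace_eq_zero, LinearMap.trace_one, LinearMap.comp_apply, h.J00, h.J11, h.J22, map_neg,
    proj_apply, smul_eq_mul]
  ring

theorem proj_proj (h : IsParahypercomplex J) (B : Bil V) : proj J (proj J B) = proj J B := by
  ext X Y
  simp only [proj_apply, h.J00, h.J11, h.J22, h.J01, h.J02, h.J10, h.J12, h.J20, h.J21, map_neg,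
    LinearMap.neg_apply]
  ring

theorem mem_hermForms (h : Corresponds G J) {B : Bil V} :
    B ∈ hermForms G ↔ ∀ a X Y, B (J a X) Y = -B X (J a Y) := by
  refine ⟨fun hB a X Y => hB _ (h.J_mem a) X Y, fun hB A hA X Y => ?_⟩
  obtain ⟨c, rfl⟩ := h.mem_iff.1 hA
  simp [Fin.sum_univ_three, hB]
  ring

theorem mem_hermForms_iff_proj (h : Corresponds G J) {B : Bil V} :
    B ∈ hermForms G ↔ proj J B = B := by
  have hp := h.parahypercomplex
  rw [mem_hermForms h]
  constructor
  · intro hB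
    ext X Y
    simp only [proj_apply, hB, hp.J00, hp.J11, hp.J22, map_neg]
    ring
  · intro hB a X Y
    rw [← hB]
    simp only [proj_apply]
    fin_cases a <;>
    simp [hp.J00, hp.J11, hp.J22, hp.J01, hp.J02, hp.J10, hp.J12, hp.J20, hp.J21] <;> ring

theorem proj_swap {c : ℝ} {B : Bil V} (hB : ∀ X Y, B X Y = c * B Y X) (X Y : V) :
    proj J B X Y = c * proj J B Y X := by
  rw [proj_apply, proj_apply, hB X, hB (J 0 X), hB (J 1 X), hB (J 2 X)]
  ring

theorem mem_symMix (h : IsParahypercomplex J) {B : Bil V} :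
    B ∈ symMix J ↔ B ∈ symForms V ∧ proj J B = 0 := by
  constructor
  · rintro ⟨C, hC, rfl⟩
    refine ⟨fun X Y => ?_, by simp [proj_proj h]⟩
    have := proj_swap (J := J) (c := 1) (B := C) (fun X Y => (hC X Y).trans (one_mul _).symm) X Y
    simp only [LinearMap.sub_apply, LinearMap.id_apply, hC X Y, this, one_mul]
  · rintro ⟨h1, h2⟩
    exact ⟨B, h1, by simp [h2]⟩

theorem mem_skewMix (h : IsParahypercomplex J) {B : Bil V} :
    B ∈ skewMix J ↔ B ∈ skewForms V ∧ proj J B = 0 := by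
  constructor
  · rintro ⟨C, hC, rfl⟩
    refine ⟨fun X Y => ?_, by simp [proj_proj h]⟩
    have := proj_swap (J := J) (c := -1) (B := C) (fun X Y => (hC X Y).trans (neg_one_mul _).symm) X Y
    simp only [LinearMap.sub_apply, LinearMap.id_apply, hC X Y, this]
    ring
  · rintro ⟨h1, h2⟩
    exact ⟨B, h1, by simp [h2]⟩

/-- The map preserves symmetry type and commutes with Π, and its scalars N + 4, N + 8 and N are all
positive. The three stages of the proof remove the corresponding components of B in this order. -/
theorem ric_phi_injective [FiniteDimensional ℝ V] [Nontrivial V] (h : IsParahypercomplex J) :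
    Function.Injective (ric ∘ₗ phi J) := by
  rw [← LinearMap.ker_eq_bot, LinearMap.ker_eq_bot']
  intro B hB
  have hN : (0 : ℝ) < Module.finrank ℝ V := by exact_mod_cast Module.finrank_pos
  have h1 : ∀ Y Z, ((Module.finrank ℝ V : ℝ) + 2) * B Y Z - 2 * B Z Y +
      4 * (proj J B Y Z + proj J B Z Y) = 0 := fun Y Z => by
    rw [← ric_phi h]
    exact LinearMap.congr_fun₂ hB Y Z
  have hskew : ∀ Y Z, B Y Z = B Z Y := fun Y Z => by
    have h3 : ((Module.finrank ℝ V : ℝ) + 4) * (B Y Z - B Z Y) = 0 := by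
      linear_combination h1 Y Z - h1 Z Y
    have := (mul_eq_zero.1 h3).resolve_left (by positivity)
    linarith
  have hs : ∀ Y Z, proj J B Y Z = proj J B Z Y := fun Y Z => by
    simpa using proj_swap (J := J) (c := 1) (B := B) (by simpa using hskew) Y Z
  have hproj : proj J B = 0 := by
    ext Y Z
    have e := h1 Y Z
    have e0 := h1 (J 0 Y) (J 0 Z)
    have e1 := h1 (J 1 Y) (J 1 Z)
    -- The signed sum of the identity over (Y, Z) and the three pairs (J_a Y, J_a Z) applies Π to
    -- it.
    have e2 := h1 (J 2 Y) (J 2 Z)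
    have p := LinearMap.congr_fun₂ (proj_proj h B) Y Z
    simp only [hs Z Y, hskew Z Y, hs (J 0 Z), hskew (J 0 Z), hs (J 1 Z), hskew (J 1 Z),
      hs (J 2 Z), hskew (J 2 Z)] at e e0 e1 e2
    have h3 : ((Module.finrank ℝ V : ℝ) + 8) * proj J B Y Z = 0 := by
      rw [proj_apply J (proj J B)] at p
      rw [proj_apply J B Y Z] at p e ⊢
      linear_combination (e + e0 - e1 - e2) / 4 - 8 * p
    simpa using (mul_eq_zero.1 h3).resolve_left (by positivity)
  ext Y Z
  have e := h1 Y Z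
  rw [hproj, hskew Z Y] at e
  have h3 : (Module.finrank ℝ V : ℝ) * B Y Z = 0 := by
    simp only [LinearMap.zero_apply] at e
    linear_combination e
  simpa [hN.ne'] using h3

theorem phi_injective [FiniteDimensional ℝ V] [Nontrivial V] (h : IsParahypercomplex J) :
    Function.Injective (phi J) :=
  fun _ _ hBC => ric_phi_injective h (congrArg ric hBC)

theorem exists_ric_phi_eq [FiniteDimensional ℝ V] [Nontrivial V] (h : IsParahypercomplex J)
    (C : Bil V) : ∃ B, ric (phi J B) = C :=
  LinearMap.surjective_of_injective (ric_phi_injective h) C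

theorem curv_autG_isDirectSum [FiniteDimensional ℝ V] (h : Corresponds G J) :
    IsDirectSum ![weyl G, rSymHerm G J, rSymMix J, rSkewHerm G J, rSkewMix J]
      (curv (autG G)) := by
  have := h.nontrivial
  have hp := h.parahypercomplex
  have hle : ∀ S : Submodule ℝ (Bil V), S.map (phi J) ≤ curv (autG G) := by
    rintro S _ ⟨B, -, rfl⟩
    exact phi_mem_curv h B
  refine isDirectSum_of _ _ ?_ ?_ ?_
  · simp only [Fin.forall_fin_succ, Matrix.cons_val_zero, Matrix.cons_val_succ, IsEmpty.forall_iff,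
      and_true]
    exact ⟨inf_le_left, hle _, hle _, hle _, hle _⟩
  · intro R hR
    -- Matching the Ricci tensor of R leaves a remainder in W; the four other terms come from
    -- splitting B by symmetry and by Π.
    obtain ⟨B, hB⟩ := exists_ric_phi_eq hp (ric R)
    let S : Bil V := (1 / 2 : ℝ) • (B + B.flip)
    let K : Bil V := (1 / 2 : ℝ) • (B - B.flip)
    have hS : S ∈ symForms V := fun X Y => by simp [S]; ring
    have hK : K ∈ skewForms V := fun X Y => by simp [K]; ring
    have hS' := proj_swap (J := J) (c := 1) (B := S) (fun X Y => (hS X Y).trans (one_mul _).symm)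
    have hK' := proj_swap (J := J) (c := -1) (B := K) (fun X Y => (hK X Y).trans (neg_one_mul _).symm)
    have hSK : S + K = B := by ext X Y; simp [S, K]; ring
    refine ⟨![R - phi J B, phi J (proj J S), phi J (S - proj J S), phi J (proj J K),
      phi J (K - proj J K)], ?_, ?_⟩
    · simp only [Fin.forall_fin_succ, Matrix.cons_val_zero, Matrix.cons_val_succ,
        IsEmpty.forall_iff, and_true]
      refine ⟨⟨sub_mem hR (phi_mem_curv h B), by simp [hB]⟩, ⟨_, ⟨fun X Y => ?_, ?_⟩, rfl⟩,
        ⟨_, ⟨S, hS, by simp⟩, rfl⟩, ⟨_, ⟨fun X Y => ?_, ?_⟩, rfl⟩, ⟨_, ⟨K, hK, by simp⟩, rfl⟩⟩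
      · simpa using hS' X Y
      · exact (mem_hermForms_iff_proj h).2 (proj_proj hp _)
      · simpa using hK' X Y
      · exact (mem_hermForms_iff_proj h).2 (proj_proj hp _)
    · simp only [Fin.sum_univ_five, Matrix.cons_val]
      rw [map_sub, map_sub, ← hSK, map_add]
      abel
  · intro f hf hs
    simp only [Fin.forall_fin_succ, Matrix.cons_val_zero, Matrix.cons_val_succ, IsEmpty.forall_iff,
      and_true] at hf
    obtain ⟨h0, ⟨B1, h1, e1⟩, ⟨B2, h2, e2⟩, ⟨B3, h3, e3⟩, ⟨B4, h4, e4⟩⟩ := hf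
    replace h2 := (mem_symMix hp).1 h2
    replace h4 := (mem_skewMix hp).1 h4
    have h1p := (mem_hermForms_iff_proj h).1 h1.2
    have h3p := (mem_hermForms_iff_proj h).1 h3.2
    simp only [Fin.sum_univ_five] at hs
    change phi J B1 = f 1 at e1
    change phi J B2 = f 2 at e2
    change phi J B3 = f 3 at e3
    change phi J B4 = f 4 at e4
    rw [← e1, ← e2, ← e3, ← e4] at hs
    have hr := congrArg ric hs
    have h0r : ric (f 0) = 0 := h0.2
    rw [map_add, map_add, map_add, map_add, h0r, zero_add, map_zero, ← map_add, ← map_add,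
      ← map_add, ← map_add, ← map_add, ← map_add] at hr
    have hB : B1 + B2 + B3 + B4 = 0 := ric_phi_injective hp (by simpa using hr)
    -- Π fixes the hermitian summands and kills the mixed ones; symmetry then separates the rest.
    have hpB : B1 + B3 = 0 := by
      have := congrArg (proj J) hB
      simpa [h1p, h2.2, h3p, h4.2] using this
    have hsep : ∀ C D : Bil V, C ∈ symForms V → D ∈ skewForms V → C + D = 0 → C = 0 ∧ D = 0 := by
      intro C D hC hD hCD
      have hD' : D = -C := eq_neg_of_add_eq_zero_right hCD
      have hC0 : C = 0 := by
        ext X Y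
        have e1 : C X Y = C Y X := hC X Y
        have e2 : D X Y = -D Y X := hD X Y
        rw [hD', LinearMap.neg_apply, LinearMap.neg_apply, LinearMap.neg_apply,
          LinearMap.neg_apply] at e2
        simp only [LinearMap.zero_apply]
        linarith
      exact ⟨hC0, by rw [hD', hC0, neg_zero]⟩
    obtain ⟨k1, k3⟩ := hsep B1 B3 h1.1 h3.1 hpB
    obtain ⟨k2, k4⟩ := hsep B2 B4 h2.1 h4.1 (by simpa [k1, k3] using hB)
    have k0 : f 0 = 0 := by simpa [k1, k2, k3, k4] using hs
    simp only [Fin.forall_fin_succ, IsEmpty.forall_iff, and_true]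
    refine ⟨k0, e1 ▸ ?_, e2 ▸ ?_, e3 ▸ ?_, e4 ▸ ?_⟩ <;> simp [k1, k2, k3, k4]

/-! ### Invariance -/

/-- Stated for an arbitrary `A`, where `autG A` is just its normalizer, because it is needed for
aut(G), for aut(H) and, in dimension four, for G and G'. -/
theorem curv_invariant {A : LieSubalgebra ℝ (Module.End ℝ V)} : Invariant (autG A) (curv A) := by
  rintro L hL R ⟨h1, h2, h3⟩
  rw [mem_autG] at hL
  refine ⟨fun X => ?_, fun X Y => ?_, fun X Y Z => ?_⟩
  · ext Z
    have hs : R (L X) X Z + R X (L X) Z = 0 := by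
      have := LinearMap.congr_fun (h1 (L X + X)) Z
      simpa [h1] using this
    rw [lie_tens_apply, h1]
    simp only [LinearMap.zero_apply, map_zero]
    linear_combination (norm := module) -hs
  · have e : ⁅L, R⁆ X Y = ⁅L, R X Y⁆ - R (L X) Y - R X (L Y) := by
      ext Z
      rw [lie_tens_apply]
      simp [LieRing.of_associative_ring_bracket]
    rw [e]
    exact sub_mem (sub_mem (hL _ (h2 X Y)) (h2 _ _)) (h2 _ _)
  · simp only [lie_tens_apply]
    have := congrArg L (h3 X Y Z)
    rw [map_add, map_add, map_zero] at this
    linear_combination (norm := module) this - h3 (L X) Y Z - h3 X (L Y) Z - h3 X Y (L Z)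

theorem ker_ric_invariant [FiniteDimensional ℝ V] (A : LieSubalgebra ℝ (Module.End ℝ V)) :
    Invariant A (LinearMap.ker (ric (V := V))) := by
  intro L _ R hR
  rw [LinearMap.mem_ker] at hR ⊢
  have h : ∀ Y Z, LinearMap.trace ℝ V ((R.flip Y).flip Z) = 0 := fun Y Z =>
    LinearMap.congr_fun₂ hR Y Z
  ext Y Z
  have e : (⁅L, R⁆.flip Y).flip Z = L * (R.flip Y).flip Z - (R.flip Y).flip (L Z)
      - (R.flip Y).flip Z * L - (R.flip (L Y)).flip Z := by
    ext X
    simp only [LinearMap.flip_apply, lie_tens_apply, LinearMap.sub_apply, Module.End.mul_apply]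
  rw [ric_apply, e, map_sub, map_sub, map_sub, h, h, LinearMap.trace_mul_comm]
  simp

theorem Invariant.inf {A : LieSubalgebra ℝ (Module.End ℝ V)} {p q : Submodule ℝ (Tens V)}
    (hp : Invariant A p) (hq : Invariant A q) : Invariant A (p ⊓ q) :=
  fun L hL R hR => ⟨hp L hL R hR.1, hq L hL R hR.2⟩

theorem weyl_invariant [FiniteDimensional ℝ V] : Invariant (autG G) (weyl G) :=
  Invariant.inf (curv_invariant.mono le_autG) (ker_ric_invariant _)

theorem map_phi_invariant [FiniteDimensional ℝ V] (h : Corresponds G J)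
    {A : LieSubalgebra ℝ (Module.End ℝ V)} (hA : A ≤ autG G)
    {S : Submodule ℝ (Bil V)} (hS : ∀ L ∈ A, ∀ B ∈ S, formAct L B ∈ S) :
    Invariant A (S.map (phi J)) := by
  rintro L hL _ ⟨B, hB, rfl⟩
  exact ⟨_, hS L hL B hB, phi_formAct h (hA hL) B⟩

theorem map_phi_isMinimal [FiniteDimensional ℝ V] (h : Corresponds G J)
    {A : LieSubalgebra ℝ (Module.End ℝ V)} (hA : A ≤ autG G)
    {S : Submodule ℝ (Bil V)} (h0 : S ≠ ⊥) (hS : ∀ q ≤ S, (∀ L ∈ A, ∀ B ∈ q, formAct L B ∈ q) →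
      q ≠ ⊥ → S ≤ q) : IsMinimal A (S.map (phi J)) := by
  have := h.nontrivial
  have hinj := phi_injective h.parahypercomplex
  refine ⟨fun hb => h0 ?_, fun q hq hi hb => ?_⟩
  · exact Submodule.map_injective_of_injective hinj (hb.trans (Submodule.map_bot _).symm)
  · have e : (q.comap (phi J)).map (phi J) = q :=
      Submodule.map_comap_eq_of_le (hq.trans (LinearMap.map_le_range))
    have hle : q.comap (phi J) ≤ S := by
      intro B hB
      obtain ⟨C, hC, hCB⟩ := hq hB
      exact hinj hCB ▸ hC
    rw [← e]
    refine Submodule.map_mono (hS _ hle (fun L hL B hB => ?_) (fun hb' => hb ?_))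
    · rw [Submodule.mem_comap, phi_formAct h (hA hL)]
      exact hi L hL _ hB
    · rw [← e, hb', Submodule.map_bot]

theorem symForms_formAct {L : Module.End ℝ V} {B : Bil V} (hB : B ∈ symForms V) :
    formAct L B ∈ symForms V := fun X Y => by
  rw [formAct_apply, formAct_apply, hB (L X), hB X]
  ring

theorem skewForms_formAct {L : Module.End ℝ V} {B : Bil V} (hB : B ∈ skewForms V) :
    formAct L B ∈ skewForms V := fun X Y => by
  rw [formAct_apply, formAct_apply, hB (L X), hB X]
  ring

theorem proj_formAct [FiniteDimensional ℝ V] (h : Corresponds G J) {L : Module.End ℝ V}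
    (hL : L ∈ autG G) (B : Bil V) : proj J (formAct L B) = formAct L (proj J B) := by
  obtain ⟨p, q, s, h0, h1, h2⟩ := h.autG_spec hL
  ext X Y
  simp only [formAct_apply, proj_apply, h0, h1, h2, map_add, map_sub, map_smul, smul_eq_mul,
    LinearMap.add_apply, LinearMap.sub_apply, LinearMap.smul_apply]
  ring

theorem hermForms_formAct [FiniteDimensional ℝ V] (h : Corresponds G J) {L : Module.End ℝ V}
    (hL : L ∈ autG G) {B : Bil V} (hB : B ∈ hermForms G) : formAct L B ∈ hermForms G := by
  rw [mem_hermForms_iff_proj h] at hB ⊢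
  rw [proj_formAct h hL, hB]

theorem symMix_formAct [FiniteDimensional ℝ V] (h : Corresponds G J) {L : Module.End ℝ V}
    (hL : L ∈ autG G) {B : Bil V} (hB : B ∈ symMix J) : formAct L B ∈ symMix J := by
  rw [mem_symMix h.parahypercomplex] at hB ⊢
  refine ⟨symForms_formAct hB.1, ?_⟩
  rw [proj_formAct h hL, hB.2]
  ext; simp [formAct_apply]

theorem skewMix_formAct [FiniteDimensional ℝ V] (h : Corresponds G J) {L : Module.End ℝ V}
    (hL : L ∈ autG G) {B : Bil V} (hB : B ∈ skewMix J) : formAct L B ∈ skewMix J := by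
  rw [mem_skewMix h.parahypercomplex] at hB ⊢
  refine ⟨skewForms_formAct hB.1, ?_⟩
  rw [proj_formAct h hL, hB.2]
  ext; simp [formAct_apply]

end

/-! ### Splitting `V = E ⊗ ℝ²` -/

/-- An identification of `V` with `E ⊗ ℝ²` in which `J` acts by the standard `2 × 2` matrices. -/
structure Splitting (J : Fin 3 → Module.End ℝ V) (E : Type*) [AddCommGroup E] [Module ℝ E] where
  /-- The two inclusions of `E`. -/
  emb : Fin 2 → E →ₗ[ℝ] V
  /-- The two projections onto `E`. -/
  coord : Fin 2 → V →ₗ[ℝ] E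
  coord_emb : ∀ i j x, coord i (emb j x) = if i = j then x else 0
  emb_coord : ∀ X, emb 0 (coord 0 X) + emb 1 (coord 1 X) = X
  J0_emb0 : ∀ x, J 0 (emb 0 x) = emb 1 x
  J0_emb1 : ∀ x, J 0 (emb 1 x) = -emb 0 x
  J1_emb0 : ∀ x, J 1 (emb 0 x) = emb 0 x
  J1_emb1 : ∀ x, J 1 (emb 1 x) = -emb 1 x
  J2_emb0 : ∀ x, J 2 (emb 0 x) = emb 1 x
  J2_emb1 : ∀ x, J 2 (emb 1 x) = emb 0 x

/-- The splitting of `V` along the eigenspaces of `J₂`. -/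
noncomputable def IsParahypercomplex.splitting {J : Fin 3 → Module.End ℝ V}
    (h : IsParahypercomplex J) : Splitting J (LinearMap.ker (J 1 - 1)) where
  emb := ![Submodule.subtype _, J 0 ∘ₗ Submodule.subtype _]
  -- `J 0` anticommutes with `J 1` and swaps its eigenspaces. The first entry projects onto the +1
  -- eigenspace; (J 2 - J 0)/2 vanishes there and equals -J 0, the inverse of J 0, on the -1
  -- eigenspace.
  coord := ![((1 / 2 : ℝ) • (1 + J 1)).codRestrict _ (fun x => by simp [h.J11, add_comm]),
    ((1 / 2 : ℝ) • (J 2 - J 0)).codRestrict _ (fun x => by simp [h.J12, h.J10]; module)]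
  coord_emb := by
    have hx : ∀ x : LinearMap.ker (J 1 - 1), J 1 (x : V) = x := fun x =>
      sub_eq_zero.1 (LinearMap.mem_ker.1 x.2)
    have h0 : ∀ x : LinearMap.ker (J 1 - 1), J 2 (x : V) = J 0 x := fun x => by
      rw [← h.J01, hx]
    simp only [Fin.forall_fin_two]
    refine ⟨⟨fun x => ?_, fun x => ?_⟩, fun x => ?_, fun x => ?_⟩ <;> ext <;>
      simp [hx, h0, h.J10, h.J20, h.J00] <;> module
  emb_coord X := by
    simp [h.J02, h.J00]
    module
  J0_emb0 x := rfl
  J0_emb1 x := by simp [h.J00]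
  J1_emb0 x := sub_eq_zero.1 (LinearMap.mem_ker.1 x.2)
  J1_emb1 x := by
    have hx : J 1 (x : V) = x := sub_eq_zero.1 (LinearMap.mem_ker.1 x.2)
    have h0 : J 2 (x : V) = J 0 x := by rw [← h.J01, hx]
    simp [h.J10, h0]
  J2_emb0 x := by
    have hx : J 1 (x : V) = x := sub_eq_zero.1 (LinearMap.mem_ker.1 x.2)
    change J 2 (x : V) = J 0 x
    rw [← h.J01, hx]
  J2_emb1 x := by
    have hx : J 1 (x : V) = x := sub_eq_zero.1 (LinearMap.mem_ker.1 x.2)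
    simp [h.J20, hx]

namespace Splitting

variable {J : Fin 3 → Module.End ℝ V} {E : Type*} [AddCommGroup E] [Module ℝ E]
  (S : Splitting J E)
include S

@[simp] theorem coord_emb_self (i : Fin 2) (x : E) : S.coord i (S.emb i x) = x := by
  simp [S.coord_emb]

@[simp] theorem coord_zero_emb_one (x : E) : S.coord 0 (S.emb 1 x) = 0 := by
  simp [S.coord_emb]

@[simp] theorem coord_one_emb_zero (x : E) : S.coord 1 (S.emb 0 x) = 0 := by
  simp [S.coord_emb]

/-- `V` is the sum of two copies of `E`. -/
noncomputable def equiv : V ≃ₗ[ℝ] E × E :=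
  LinearEquiv.ofLinearMap ((S.coord 0).prod (S.coord 1)) ((S.emb 0).coprod (S.emb 1))
    (by ext <;> simp) (by ext X; simp [S.emb_coord])

theorem finiteDimensional [FiniteDimensional ℝ V] : FiniteDimensional ℝ E :=
  FiniteDimensional.of_injective (S.emb 0) fun x y hxy => by
    simpa using congrArg (S.coord 0) hxy

theorem finrank_eq [FiniteDimensional ℝ V] : Module.finrank ℝ V = 2 * Module.finrank ℝ E := by
  have := S.finiteDimensional
  rw [S.equiv.finrank_eq, Module.finrank_prod]
  ring

theorem hom_ext {M : Type*} [AddCommGroup M] [Module ℝ M] {f g : V →ₗ[ℝ] M}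
    (h : ∀ i x, f (S.emb i x) = g (S.emb i x)) : f = g := by
  ext X
  rw [← S.emb_coord X, map_add, map_add, h, h]

theorem bil_ext {B C : Bil V}
    (h : ∀ i j x y, B (S.emb i x) (S.emb j y) = C (S.emb i x) (S.emb j y)) : B = C :=
  S.hom_ext fun i x => S.hom_ext fun j y => h i j x y

theorem coord_J (X : V) : S.coord 0 (J 0 X) = -S.coord 1 X ∧ S.coord 1 (J 0 X) = S.coord 0 X ∧
    S.coord 0 (J 1 X) = S.coord 0 X ∧ S.coord 1 (J 1 X) = -S.coord 1 X ∧
    S.coord 0 (J 2 X) = S.coord 1 X ∧ S.coord 1 (J 2 X) = S.coord 0 X := by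
  have h : ∀ a, J a X = J a (S.emb 0 (S.coord 0 X)) + J a (S.emb 1 (S.coord 1 X)) := fun a => by
    rw [← map_add, S.emb_coord]
  simp [h, S.J0_emb0, S.J0_emb1, S.J1_emb0, S.J1_emb1, S.J2_emb0, S.J2_emb1]

/-- The endomorphism `A ⊗ 1` of `V = E ⊗ ℝ²`. -/
noncomputable def lift (A : Module.End ℝ E) : Module.End ℝ V :=
  S.emb 0 ∘ₗ A ∘ₗ S.coord 0 + S.emb 1 ∘ₗ A ∘ₗ S.coord 1

@[simp] theorem lift_emb (A : Module.End ℝ E) (i : Fin 2) (x : E) :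
    S.lift A (S.emb i x) = S.emb i (A x) := by
  fin_cases i <;> simp [lift]

theorem lift_mem_autH (A : Module.End ℝ E) : S.lift A ∈ autH J := by
  rw [mem_autH]
  intro a X
  have := S.coord_J X
  fin_cases a <;>
  simp [lift, this, S.J0_emb0, S.J0_emb1, S.J1_emb0, S.J1_emb1, S.J2_emb0, S.J2_emb1] <;> abel

theorem lift_mul (A B : Module.End ℝ E) : S.lift (A * B) = S.lift A * S.lift B :=
  S.hom_ext fun i x => by simp

theorem lift_add (A B : Module.End ℝ E) : S.lift (A + B) = S.lift A + S.lift B :=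
  S.hom_ext fun i x => by simp

theorem lift_smul (c : ℝ) (A : Module.End ℝ E) : S.lift (c • A) = c • S.lift A :=
  S.hom_ext fun i x => by simp

theorem lift_one : S.lift 1 = 1 := S.hom_ext fun i x => by simp

/-- Elements of `aut(H)` are of the form `A ⊗ 1`. -/
theorem exists_lift_eq {L : Module.End ℝ V} (hL : L ∈ autH J) :
    S.lift (S.coord 0 ∘ₗ L ∘ₗ S.emb 0) = L := by
  rw [mem_autH] at hL
  -- Commuting with `J 1` keeps L block diagonal; commuting with `J 0` makes both blocks equal.
  have h0 : ∀ x, S.emb 0 (S.coord 0 (L (S.emb 0 x))) = L (S.emb 0 x) := fun x => by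
    have h1 := hL 1 (S.emb 0 x)
    rw [S.J1_emb0] at h1
    have h2 := (S.coord_J (L (S.emb 0 x))).2.2.2.1
    rw [← h1, eq_neg_iff_add_eq_zero, ← two_smul ℝ, smul_eq_zero_iff_right two_ne_zero] at h2
    have h3 := S.emb_coord (L (S.emb 0 x))
    rwa [h2, map_zero, add_zero] at h3
  refine S.hom_ext fun i x => ?_
  fin_cases i
  · simp [h0]
  · simp only [Fin.mk_one, lift_emb, LinearMap.comp_apply]
    rw [← S.J0_emb0, h0, ← S.J0_emb0, hL]

/-- The endomorphism `1 ⊗ E_{ki}` of `V = E ⊗ ℝ²`. -/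
noncomputable def unit (k i : Fin 2) : Module.End ℝ V := S.emb k ∘ₗ S.coord i

theorem unit_emb (k i j : Fin 2) (x : E) :
    S.unit k i (S.emb j x) = if i = j then S.emb k x else 0 := by
  simp [unit, S.coord_emb]
  split_ifs <;> simp

theorem unit_mul (k i l j : Fin 2) : S.unit k i * S.unit l j = if i = l then S.unit k j else 0 := by
  refine S.hom_ext fun a x => ?_
  rw [Module.End.mul_apply, S.unit_emb]
  split_ifs with h1 h2 h2 <;> simp [S.unit_emb, h1, h2]

theorem unit_mem_autG {G : LieSubalgebra ℝ (Module.End ℝ V)} (h : Corresponds G J)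
    (k i : Fin 2) : S.unit k i ∈ autG G := by
  have hJ := fun a => le_autG (h.J_mem a)
  have h1 := h.autH_le one_mem_autH
  have e00 : S.unit 0 0 = (1 / 2 : ℝ) • (1 + J 1) := S.hom_ext fun a x => by
    fin_cases a <;> simp [S.unit_emb, S.J1_emb0, S.J1_emb1]; module
  have e11 : S.unit 1 1 = (1 / 2 : ℝ) • (1 - J 1) := S.hom_ext fun a x => by
    fin_cases a <;> simp [S.unit_emb, S.J1_emb0, S.J1_emb1]; module
  have e10 : S.unit 1 0 = (1 / 2 : ℝ) • (J 0 + J 2) := S.hom_ext fun a x => by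
    fin_cases a <;> simp [S.unit_emb, S.J0_emb0, S.J0_emb1, S.J2_emb0, S.J2_emb1]; module
  have e01 : S.unit 0 1 = (1 / 2 : ℝ) • (J 2 - J 0) := S.hom_ext fun a x => by
    fin_cases a <;> simp [S.unit_emb, S.J0_emb0, S.J0_emb1, S.J2_emb0, S.J2_emb1]; module
  have h00 : S.unit 0 0 ∈ autG G := e00 ▸ (autG G).smul_mem _ (add_mem h1 (hJ 1))
  have h11 : S.unit 1 1 ∈ autG G := e11 ▸ (autG G).smul_mem _ (sub_mem h1 (hJ 1))
  have h10 : S.unit 1 0 ∈ autG G := e10 ▸ (autG G).smul_mem _ (add_mem (hJ 0) (hJ 2))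
  have h01 : S.unit 0 1 ∈ autG G := e01 ▸ (autG G).smul_mem _ (sub_mem (hJ 2) (hJ 0))
  fin_cases k <;> fin_cases i <;> assumption

end Splitting

/-! ### Irreducibility of the modules of bilinear forms -/

/-- A Lie-invariant subspace is stable under the polarised substitution because it equals a·(b·B) +
(ba)·B. The product `b * a` has to lie in `A`, which holds in the associative algebra aut(H) and for
matrix units. -/
theorem compl₁₂_add_mem {A : LieSubalgebra ℝ (Module.End ℝ V)} {q : Submodule ℝ (Bil V)}
    (hq : ∀ L ∈ A, ∀ B ∈ q, formAct L B ∈ q) {B : Bil V} (hB : B ∈ q) {a b : Module.End ℝ V}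
    (ha : a ∈ A) (hb : b ∈ A) (hba : b * a ∈ A) : B.compl₁₂ a b + B.compl₁₂ b a ∈ q := by
  have e : B.compl₁₂ a b + B.compl₁₂ b a = formAct a (formAct b B) + formAct (b * a) B := by
    ext X Y
    simp [formAct_apply]
    ring
  rw [e]
  exact add_mem (hq a ha _ (hq b hb B hB)) (hq _ hba B hB)

theorem sum_repr_mul_repr {E ι : Type*} [AddCommGroup E] [Module ℝ E] [Fintype ι]
    (b : Module.Basis ι ℝ E) (g : Bil E) (x y : E) :
    ∑ r, ∑ s, g (b r) (b s) * (b.coord r x * b.coord s y) = g x y := by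
  conv_rhs => rw [← b.sum_repr x, ← b.sum_repr y]
  simp only [map_sum, map_smul, LinearMap.sum_apply, LinearMap.smul_apply, smul_eq_mul,
    Finset.mul_sum, Module.Basis.coord_apply]
  rw [Finset.sum_comm]
  exact Finset.sum_congr rfl fun r _ => Finset.sum_congr rfl fun s _ => by ring

section

variable {G : LieSubalgebra ℝ (Module.End ℝ V)} {J : Fin 3 → Module.End ℝ V}
  {E : Type*} [AddCommGroup E] [Module ℝ E]

/-- Rank one operators with images e and f turn B into products of coordinate functions on E, scaled
by the values of B at (e, f). The basis expansion of g then assembles any form of the right symmetry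
`s`, leaving the ℝ² indices untouched. -/
theorem Splitting.exists_mem_of_invariant [FiniteDimensional ℝ E] (S : Splitting J E)
    {q : Submodule ℝ (Bil V)}
    (hq : ∀ L ∈ autH J, ∀ B ∈ q, formAct L B ∈ q) {B : Bil V} (hB : B ∈ q) {s : ℝ}
    (hs : s * s = 1)
    (hsym : ∀ k l x y, B (S.emb k y) (S.emb l x) = s * B (S.emb k x) (S.emb l y))
    (g : Bil E) (hg : ∀ x y, g y x = s * g x y) (e f : E) :
    ∃ c ∈ q, ∀ k l x y, c (S.emb k x) (S.emb l y) = g x y * B (S.emb k e) (S.emb l f) := by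
  let b := Module.finBasis ℝ E
  let a : E → (E →ₗ[ℝ] ℝ) → Module.End ℝ V := fun v α => S.lift (α.smulRight v)
  have ha : ∀ v α, a v α ∈ autH J := fun v α => S.lift_mem_autH _
  let Q : Fin (Module.finrank ℝ E) → Fin (Module.finrank ℝ E) → Bil V := fun r t =>
    B.compl₁₂ (a e (b.coord r)) (a f (b.coord t)) + B.compl₁₂ (a f (b.coord t)) (a e (b.coord r))
  have hQ : ∀ r t, Q r t ∈ q := fun r t =>
    compl₁₂_add_mem hq hB (ha _ _) (ha _ _) (mul_mem_autH (ha _ _) (ha _ _))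
  refine ⟨∑ r, ∑ t, (g (b r) (b t) / 2) • Q r t, Submodule.sum_mem _ fun r _ =>
    Submodule.sum_mem _ fun t _ => q.smul_mem _ (hQ r t), fun k l x y => ?_⟩
  have h1 := sum_repr_mul_repr b g x y
  have h2 := sum_repr_mul_repr b g y x
  have e1 : ∀ r t, Q r t (S.emb k x) (S.emb l y) = (b.coord r x * b.coord t y +
      s * (b.coord r y * b.coord t x)) * B (S.emb k e) (S.emb l f) := fun r t => by
    simp only [Q, a, LinearMap.add_apply, LinearMap.compl₁₂_apply, S.lift_emb,
      LinearMap.smulRight_apply, map_smul, LinearMap.smul_apply, smul_eq_mul]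
    rw [hsym k l e f]
    ring
  simp only [LinearMap.sum_apply, LinearMap.smul_apply, e1, smul_eq_mul]
  have e2 : ∀ r t, g (b r) (b t) / 2 * ((b.coord r x * b.coord t y +
      s * (b.coord r y * b.coord t x)) * B (S.emb k e) (S.emb l f)) =
      (B (S.emb k e) (S.emb l f) / 2) * (g (b r) (b t) * (b.coord r x * b.coord t y)) +
      (s * B (S.emb k e) (S.emb l f) / 2) * (g (b r) (b t) * (b.coord r y * b.coord t x)) :=
    fun r t => by ring
  simp only [e2, Finset.sum_add_distrib, ← Finset.mul_sum, h1, h2]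
  -- The sum is (g(x, y) + s g(y, x))/2 times the value of B, which is why each coefficient carries
  -- a factor 1/2.
  rw [hg x y]
  linear_combination (g x y * B (S.emb k e) (S.emb l f) / 2) * hs

/-- A hermitian form is g ⊗ ω: its blocks vanish on the diagonal and are opposite off it. -/
theorem Splitting.herm_apply (S : Splitting J E) (h : Corresponds G J) {B : Bil V}
    (hB : B ∈ hermForms G) (x y : E) : B (S.emb 0 x) (S.emb 0 y) = 0 ∧
      B (S.emb 1 x) (S.emb 1 y) = 0 ∧ B (S.emb 1 x) (S.emb 0 y) = -B (S.emb 0 x) (S.emb 1 y) := by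
  rw [mem_hermForms h] at hB
  have h1 := hB 1 (S.emb 0 x) (S.emb 0 y)
  have h2 := hB 1 (S.emb 1 x) (S.emb 1 y)
  have h3 := hB 0 (S.emb 0 x) (S.emb 0 y)
  simp only [S.J1_emb0, S.J1_emb1, S.J0_emb0, map_neg, LinearMap.neg_apply, neg_neg] at h1 h2 h3
  exact ⟨by linarith, by linarith, h3⟩

theorem Splitting.herm_ext (S : Splitting J E) (h : Corresponds G J) {B C : Bil V}
    (hB : B ∈ hermForms G) (hC : C ∈ hermForms G)
    (he : ∀ x y, B (S.emb 0 x) (S.emb 1 y) = C (S.emb 0 x) (S.emb 1 y)) : B = C := by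
  have h1 := S.herm_apply h hB
  have h2 := S.herm_apply h hC
  refine S.bil_ext fun i j x y => ?_
  fin_cases i <;> fin_cases j <;> simp [h1, h2, he]

/-- Since ω is skew, a form of symmetry `-s` on V corresponds to g of symmetry `s` on E. The action
of gl(E) is then transitive enough, so aut(H) suffices. -/
theorem Splitting.herm_minimal [FiniteDimensional ℝ E] (S : Splitting J E) (h : Corresponds G J)
    {s : ℝ} (hs : s * s = 1) {P : Submodule ℝ (Bil V)} (hP : P ≤ hermForms G)
    (hP' : ∀ B ∈ P, ∀ X Y, B X Y = -s * B Y X) {q : Submodule ℝ (Bil V)} (hqP : q ≤ P)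
    (hq : ∀ L ∈ autH J, ∀ B ∈ q, formAct L B ∈ q) (h0 : q ≠ ⊥) : P ≤ q := by
  obtain ⟨B, hB, hB0⟩ := (Submodule.ne_bot_iff q).1 h0
  have hBh := S.herm_apply h (hP (hqP hB))
  have hsw : ∀ C ∈ P, ∀ x y, C (S.emb 0 y) (S.emb 1 x) = s * C (S.emb 0 x) (S.emb 1 y) := by
    intro C hC x y
    rw [hP' C hC (S.emb 0 y), (S.herm_apply h (hP hC) _ _).2.2]
    ring
  obtain ⟨e, f, hef⟩ : ∃ e f, B (S.emb 0 e) (S.emb 1 f) ≠ 0 := by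
    by_contra! hc
    exact hB0 (S.herm_ext h (hP (hqP hB)) (zero_mem _) (by simpa using hc))
  intro C hC
  obtain ⟨c, hc, hcv⟩ := S.exists_mem_of_invariant hq hB hs (fun k l x y => by
      fin_cases k <;> fin_cases l <;> simp [hBh, hsw B (hqP hB) x y])
    ((B (S.emb 0 e) (S.emb 1 f))⁻¹ • C.compl₁₂ (S.emb 0) (S.emb 1))
    (fun x y => by simp [hsw C hC x y]; ring) e f
  have : C = c := S.herm_ext h (hP hC) (hP (hqP hc)) fun x y => by
    rw [hcv]
    simp
    field_simp
  exact this ▸ hc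

/-- The kernel of Π consists of the forms symmetric in the ℝ² indices. -/
theorem Splitting.mix_apply (S : Splitting J E) {B : Bil V} (hB : proj J B = 0) (k l : Fin 2)
    (x y : E) : B (S.emb k x) (S.emb l y) = B (S.emb l x) (S.emb k y) := by
  have h1 := LinearMap.congr_fun₂ hB (S.emb 0 x) (S.emb 1 y)
  simp [proj_apply, S.J0_emb0, S.J0_emb1, S.J1_emb0, S.J1_emb1, S.J2_emb0, S.J2_emb1] at h1
  have h2 : B (S.emb 0 x) (S.emb 1 y) = B (S.emb 1 x) (S.emb 0 y) := by linarith
  fin_cases k <;> fin_cases l <;> simp [h2]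

theorem Splitting.mix_minimal [FiniteDimensional ℝ E] [FiniteDimensional ℝ V]
    (S : Splitting J E) (h : Corresponds G J)
    {s : ℝ} (hs : s * s = 1) {P : Submodule ℝ (Bil V)} (hP : ∀ B ∈ P, proj J B = 0)
    (hP' : ∀ B ∈ P, ∀ X Y, B X Y = s * B Y X) {q : Submodule ℝ (Bil V)} (hqP : q ≤ P)
    (hq : ∀ L ∈ autG G, ∀ B ∈ q, formAct L B ∈ q) (h0 : q ≠ ⊥) : P ≤ q := by
  obtain ⟨B, hB, hB0⟩ := (Submodule.ne_bot_iff q).1 h0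
  have hsw : ∀ C ∈ P, ∀ k l x y,
      C (S.emb k y) (S.emb l x) = s * C (S.emb k x) (S.emb l y) := by
    intro C hC k l x y
    rw [hP' C hC (S.emb k y), S.mix_apply (hP C hC)]
  obtain ⟨k, l, e, f, hef⟩ : ∃ k l e f, B (S.emb k e) (S.emb l f) ≠ 0 := by
    by_contra! hc
    exact hB0 (S.bil_ext (by simpa using hc))
  -- First gl(E) produces the desired g in the block (k, l); matrix units then move that block to
  -- (i, j), symmetrised with (j, i). This second move is where aut(G) is needed instead of aut(H).
  have key : ∀ i j, ∀ g : Bil E, (∀ x y, g y x = s * g x y) → ∃ c ∈ q, ∀ a b x y,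
      c (S.emb a x) (S.emb b y) = g x y * ((if i = a then if j = b then 1 else 0 else 0) +
        (if j = a then if i = b then 1 else 0 else 0)) := by
    intro i j g hg
    obtain ⟨c, hc, hcv⟩ := S.exists_mem_of_invariant (fun L hL => hq L (h.autH_le hL)) hB hs
      (hsw B (hqP hB)) ((B (S.emb k e) (S.emb l f))⁻¹ • g) (fun x y => by simp [hg x y]; ring) e f
    refine ⟨_, compl₁₂_add_mem hq hc (S.unit_mem_autG h k i) (S.unit_mem_autG h l j) ?_,
      fun a b x y => ?_⟩
    · rw [S.unit_mul]
      split_ifs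
      · exact S.unit_mem_autG h _ _
      · exact zero_mem _
    · have h1 : ∀ x y, c (S.emb k x) (S.emb l y) = g x y := fun x y => by
        rw [hcv]
        simp
        field_simp
      have h2 : ∀ x y, c (S.emb l x) (S.emb k y) = g x y := fun x y => by
        rw [S.mix_apply (hP c (hqP hc)), h1]
      simp only [LinearMap.add_apply, LinearMap.compl₁₂_apply, S.unit_emb]
      split_ifs <;> simp [h1, h2] <;> ring
  intro C hC
  have hg : ∀ i j x y, (C.compl₁₂ (S.emb i) (S.emb j)) y x =
      s * (C.compl₁₂ (S.emb i) (S.emb j)) x y := fun i j x y => by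
    simpa using hsw C hC i j x y
  choose c hc hcv using fun i j => key i j _ (hg i j)
  -- Every block of C is hit twice, by (i, j) and by (j, i), hence the 1/2.
  have : C = (1 / 2 : ℝ) • (c 0 0 + c 0 1 + c 1 0 + c 1 1) := by
    have h1 := S.mix_apply (hP C hC) 1 0
    refine S.bil_ext fun a b x y => ?_
    simp only [LinearMap.smul_apply, LinearMap.add_apply, hcv]
    fin_cases a <;> fin_cases b <;> simp [h1] <;> ring
  rw [this]
  exact q.smul_mem _ (add_mem (add_mem (add_mem (hc _ _) (hc _ _)) (hc _ _)) (hc _ _))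

/-- The hermitian form `g ⊗ ω`. -/
noncomputable def Splitting.hermOf (S : Splitting J E) (g : Bil E) : Bil V :=
  g.compl₁₂ (S.coord 0) (S.coord 1) - g.compl₁₂ (S.coord 1) (S.coord 0)

theorem Splitting.hermOf_mem (S : Splitting J E) (h : Corresponds G J) (g : Bil E) :
    S.hermOf g ∈ hermForms G := by
  rw [mem_hermForms h]
  intro a X Y
  have h1 := S.coord_J X
  have h2 := S.coord_J Y
  fin_cases a <;> simp [hermOf, h1, h2] <;> ring

/-- A form of mixed type built from a form on `E`. -/
noncomputable def Splitting.mixOf (S : Splitting J E) (g : Bil E) : Bil V :=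
  g.compl₁₂ (S.coord 0) (S.coord 0)

theorem Splitting.proj_mixOf (S : Splitting J E) (g : Bil E) : proj J (S.mixOf g) = 0 := by
  ext X Y
  have h1 := S.coord_J X
  have h2 := S.coord_J Y
  simp [mixOf, proj_apply, h1, h2]

theorem exists_sym_ne_zero [FiniteDimensional ℝ E] (hE : 2 ≤ Module.finrank ℝ E) :
    ∃ (g : Bil E) (x y : E), (∀ x y, g x y = g y x) ∧ g x y ≠ 0 := by
  let b := Module.finBasis ℝ E
  let i : Fin (Module.finrank ℝ E) := ⟨0, by omega⟩
  refine ⟨LinearMap.mk₂ ℝ (fun x y => b.coord i x * b.coord i y) ?_ ?_ ?_ ?_, b i, b i, ?_, ?_⟩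
  · intros; simp; ring
  · intros; simp; ring
  · intros; simp; ring
  · intros; simp; ring
  · intros; simp; ring
  · simp

theorem exists_skew_ne_zero [FiniteDimensional ℝ E] (hE : 2 ≤ Module.finrank ℝ E) :
    ∃ (g : Bil E) (x y : E), (∀ x y, g x y = -g y x) ∧ g x y ≠ 0 := by
  let b := Module.finBasis ℝ E
  let i : Fin (Module.finrank ℝ E) := ⟨0, by omega⟩
  let j : Fin (Module.finrank ℝ E) := ⟨1, by omega⟩
  have hij : i ≠ j := by simp [i, j]
  refine ⟨LinearMap.mk₂ ℝ (fun x y => b.coord i x * b.coord j y - b.coord j x * b.coord i y)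
    ?_ ?_ ?_ ?_, b i, b j, ?_, ?_⟩
  · intros; simp; ring
  · intros; simp; ring
  · intros; simp; ring
  · intros; simp; ring
  · intros; simp; ring
  · simp [hij, hij.symm]

theorem skewHerm_isMinimal [FiniteDimensional ℝ V] [FiniteDimensional ℝ E] (S : Splitting J E)
    (hE : 2 ≤ Module.finrank ℝ E) (h : Corresponds G J) :
    IsMinimal (autH J) (rSkewHerm G J) := by
  refine map_phi_isMinimal h h.autH_le ?_ fun q hq hi h0 =>
    S.herm_minimal h (s := 1) (by norm_num) inf_le_right (fun B hB X Y => ?_) hq hi h0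
  -- A symmetric g is wanted for skew forms on V, because ω contributes a sign.
  · obtain ⟨g, x, y, hg, hxy⟩ := exists_sym_ne_zero hE
    refine (Submodule.ne_bot_iff _).2 ⟨S.hermOf g, ⟨fun X Y => ?_, S.hermOf_mem h g⟩, fun h0 => ?_⟩
    · simp [Splitting.hermOf, hg (S.coord 1 X), hg (S.coord 0 X)]
    · exact hxy (by simpa [Splitting.hermOf] using LinearMap.congr_fun₂ h0 (S.emb 0 x) (S.emb 1 y))
  · rw [neg_one_mul]
    exact hB.1 X Y

theorem symHerm_isMinimal [FiniteDimensional ℝ V] [FiniteDimensional ℝ E] (S : Splitting J E)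
    (hE : 2 ≤ Module.finrank ℝ E) (h : Corresponds G J) :
    IsMinimal (autH J) (rSymHerm G J) := by
  refine map_phi_isMinimal h h.autH_le ?_ fun q hq hi h0 =>
    S.herm_minimal h (s := -1) (by norm_num) inf_le_right (fun B hB X Y => ?_) hq hi h0
  · obtain ⟨g, x, y, hg, hxy⟩ := exists_skew_ne_zero hE
    refine (Submodule.ne_bot_iff _).2 ⟨S.hermOf g, ⟨fun X Y => ?_, S.hermOf_mem h g⟩, fun h0 => ?_⟩
    · simp [Splitting.hermOf, hg (S.coord 1 X), hg (S.coord 0 X)]; ring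
    · exact hxy (by simpa [Splitting.hermOf] using LinearMap.congr_fun₂ h0 (S.emb 0 x) (S.emb 1 y))
  · rw [neg_neg, one_mul]
    exact hB.1 X Y

theorem symMix_isMinimal [FiniteDimensional ℝ V] [FiniteDimensional ℝ E] (S : Splitting J E)
    (hE : 2 ≤ Module.finrank ℝ E) (h : Corresponds G J) :
    IsMinimal (autG G) (rSymMix J) := by
  have hp := h.parahypercomplex
  refine map_phi_isMinimal h le_rfl ?_ fun q hq hi h0 =>
    S.mix_minimal h (s := 1) (by norm_num) (fun B hB => ((mem_symMix hp).1 hB).2)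
      (fun B hB X Y => ?_) hq hi h0
  · obtain ⟨g, x, y, hg, hxy⟩ := exists_sym_ne_zero hE
    refine (Submodule.ne_bot_iff _).2 ⟨S.mixOf g, (mem_symMix hp).2 ⟨fun X Y => ?_,
      S.proj_mixOf g⟩, fun h0 => ?_⟩
    · simp [Splitting.mixOf, hg (S.coord 0 X)]
    · exact hxy (by simpa [Splitting.mixOf] using LinearMap.congr_fun₂ h0 (S.emb 0 x) (S.emb 0 y))
  · rw [one_mul]
    exact ((mem_symMix hp).1 hB).1 X Y

theorem skewMix_isMinimal [FiniteDimensional ℝ V] [FiniteDimensional ℝ E] (S : Splitting J E)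
    (hE : 2 ≤ Module.finrank ℝ E) (h : Corresponds G J) :
    IsMinimal (autG G) (rSkewMix J) := by
  have hp := h.parahypercomplex
  refine map_phi_isMinimal h le_rfl ?_ fun q hq hi h0 =>
    S.mix_minimal h (s := -1) (by norm_num) (fun B hB => ((mem_skewMix hp).1 hB).2)
      (fun B hB X Y => ?_) hq hi h0
  · obtain ⟨g, x, y, hg, hxy⟩ := exists_skew_ne_zero hE
    refine (Submodule.ne_bot_iff _).2 ⟨S.mixOf g, (mem_skewMix hp).2 ⟨fun X Y => ?_,
      S.proj_mixOf g⟩, fun h0 => ?_⟩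
    · simp [Splitting.mixOf, hg (S.coord 0 X)]
    · exact hxy (by simpa [Splitting.mixOf] using LinearMap.congr_fun₂ h0 (S.emb 0 x) (S.emb 0 y))
  · rw [neg_one_mul]
    exact ((mem_skewMix hp).1 hB).1 X Y

theorem rSymHerm_invariant [FiniteDimensional ℝ V] (h : Corresponds G J) :
    Invariant (autG G) (rSymHerm G J) :=
  map_phi_invariant h le_rfl fun _ hL _ hB =>
    ⟨symForms_formAct hB.1, hermForms_formAct h hL hB.2⟩

theorem rSkewHerm_invariant [FiniteDimensional ℝ V] (h : Corresponds G J) :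
    Invariant (autG G) (rSkewHerm G J) :=
  map_phi_invariant h le_rfl fun _ hL _ hB =>
    ⟨skewForms_formAct hB.1, hermForms_formAct h hL hB.2⟩

theorem rSymMix_invariant [FiniteDimensional ℝ V] (h : Corresponds G J) :
    Invariant (autG G) (rSymMix J) :=
  map_phi_invariant h le_rfl fun _ hL _ hB => symMix_formAct h hL hB

theorem rSkewMix_invariant [FiniteDimensional ℝ V] (h : Corresponds G J) :
    Invariant (autG G) (rSkewMix J) :=
  map_phi_invariant h le_rfl fun _ hL _ hB => skewMix_formAct h hL hB

end

/-! ### Curvature tensors of type `aut(H)` -/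

theorem curv_neg {A : LieSubalgebra ℝ (Module.End ℝ V)} {R : Tens V} (hR : R ∈ curv A) (X Y : V) :
    R X Y = -R Y X := by
  have := hR.1 (X + Y)
  simp [hR.1] at this
  exact eq_neg_of_add_eq_zero_left this

/-- The Bianchi identity R(X, Y)Z = R(Z, Y)X - R(Z, X)Y, composed with K and traced over Z. With K =
1 it links the trace of R to the skew part of Ric; with K = J_a it governs the G-component. -/
theorem trace_mul_curv {A : LieSubalgebra ℝ (Module.End ℝ V)} {R : Tens V} (hR : R ∈ curv A)
    (K : Module.End ℝ V) (X Y : V) : LinearMap.trace ℝ V (K * R X Y) =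
      LinearMap.trace ℝ V (K * (R.flip Y).flip X) - LinearMap.trace ℝ V (K * (R.flip X).flip Y) := by
  rw [← map_sub]
  congr 1
  ext Z
  have hs : R Y Z X + R Z Y X = 0 := by
    have := LinearMap.congr_fun (hR.1 (Y + Z)) X
    simpa [hR.1] using this
  have h := congrArg K (hR.2.2 X Y Z)
  have h' := congrArg K hs
  simp only [map_add, map_zero] at h h'
  simp only [Module.End.mul_apply, LinearMap.sub_apply, LinearMap.flip_apply]
  linear_combination (norm := module) h - h'

theorem trace_curv {A : LieSubalgebra ℝ (Module.End ℝ V)} {R : Tens V} (hR : R ∈ curv A)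
    (X Y : V) : LinearMap.trace ℝ V (R X Y) = ric R Y X - ric R X Y := by
  have := trace_mul_curv hR 1 X Y
  rwa [one_mul, one_mul, one_mul] at this

/-- The Ricci-flat curvature tensors of type `aut(H)`. -/
noncomputable def weylH (J : Fin 3 → Module.End ℝ V) : Submodule ℝ (Tens V) :=
  curv (autH J) ⊓ LinearMap.ker ric

theorem curv_mono {A A' : LieSubalgebra ℝ (Module.End ℝ V)} (h : A ≤ A') : curv A ≤ curv A' :=
  fun _ hR => ⟨hR.1, fun X Y => h (hR.2.1 X Y), hR.2.2⟩

section

variable {G : LieSubalgebra ℝ (Module.End ℝ V)} {J : Fin 3 → Module.End ℝ V}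

/-- tr(J_a R(X, Y)) = 0 and R commutes with J_a, so Bianchi makes Ric(Y, J_a X) symmetric in X and Y
for each a. Using this for all three indices gives Ric(X, Y) = Ric(J 2 Y, J 2 X) = Ric(J 0 X, J 0 Y)
= -Ric(Y, X). -/
theorem ric_mem_skewHerm (h : Corresponds G J) {R : Tens V}
    (hR : R ∈ curv (autH J)) : ric R ∈ skewHerm G := by
  have hp := h.parahypercomplex
  have key : ∀ a X Y, ric R Y (J a X) = ric R X (J a Y) := by
    intro a X Y
    have h1 := trace_mul_curv hR (J a) X Y
    have e : ∀ X Y, J a * (R.flip Y).flip X = (R.flip Y).flip (J a X) := fun X Y => by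
      ext Z
      exact (mem_autH.1 (hR.2.1 Z Y) a X).symm
    rw [hp.trace_mul (hR.2.1 X Y), e, e] at h1
    simp only [ric_apply]
    linarith
  have hs : ∀ X Y, ric R X Y = -ric R Y X := by
    intro X Y
    have h0 := key 0 (J 0 X) Y
    have h1 := key 1 (J 0 X) (J 2 Y)
    have h2 := key 2 X Y
    rw [hp.J00, map_neg] at h0
    rw [hp.J10, map_neg, hp.J12, map_neg] at h1
    have h3 := key 2 (J 2 Y) X
    rw [hp.J22] at h3
    linarith
  refine ⟨hs, (mem_hermForms h).2 fun a X Y => ?_⟩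
  rw [hs, key]

theorem ric_phi_skewHerm [FiniteDimensional ℝ V] (h : Corresponds G J) {B : Bil V}
    (hB : B ∈ skewHerm G) : ric (phi J B) = ((Module.finrank ℝ V : ℝ) + 4) • B := by
  ext Y Z
  have h1 : B Z Y = -B Y Z := hB.1 Z Y
  rw [ric_phi h.parahypercomplex, (mem_hermForms_iff_proj h).1 hB.2, h1]
  simp
  ring

theorem curv_autH_isDirectSum [FiniteDimensional ℝ V] (h : Corresponds G J) :
    IsDirectSum ![weylH J, rSkewHerm G J] (curv (autH J)) := by
  have h4 : ((Module.finrank ℝ V : ℝ) + 4) ≠ 0 := by positivity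
  refine isDirectSum_pair inf_le_left ?_ (fun R hR => ?_) ?_
  · rintro _ ⟨B, hB, rfl⟩
    exact phi_mem_curv_autH h hB
  · have hB := (skewHerm G).smul_mem ((Module.finrank ℝ V : ℝ) + 4)⁻¹ (ric_mem_skewHerm h hR)
    refine ⟨_, ⟨_, hB, rfl⟩, sub_mem hR (phi_mem_curv_autH h hB), ?_⟩
    change ric (R - _) = 0
    rw [map_sub, ric_phi_skewHerm h hB, smul_inv_smul₀ h4, sub_self]
  · rintro _ hx ⟨B, hB, rfl⟩
    have h0 : ric (phi J B) = 0 := hx.2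
    rw [ric_phi_skewHerm h hB, smul_eq_zero_iff_right h4] at h0
    rw [h0, map_zero]

theorem weylH_le_weyl (h : Corresponds G J) : weylH J ≤ weyl G :=
  inf_le_inf_right _ (curv_mono h.autH_le)

theorem weylH_invariant [FiniteDimensional ℝ V] : Invariant (autH J) (weylH J) :=
  Invariant.inf (curv_invariant.mono (LieSubalgebra.le_normalizer _)) (ker_ric_invariant _)

end

/-! ### Linear algebra of symmetric trilinear maps -/

section Trilinear

variable {E : Type*} [AddCommGroup E] [Module ℝ E]

theorem exists_dual_eq_one {x : E} (hx : x ≠ 0) : ∃ β : E →ₗ[ℝ] ℝ, β x = 1 := by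
  have : ¬ ∀ φ : Module.Dual ℝ E, φ x = 0 := fun h => hx ((Module.forall_dual_apply_eq_zero_iff ℝ x).1 h)
  push Not at this
  obtain ⟨φ, hφ⟩ := this
  exact ⟨(φ x)⁻¹ • φ, by simp [hφ]⟩

theorem eq_smul_of_dual {x v : E} {β : E →ₗ[ℝ] ℝ} (hβ : β x = 1)
    (h : ∀ α : E →ₗ[ℝ] ℝ, α x = 0 → α v = 0) : v = β v • x := by
  rw [← sub_eq_zero]
  refine (Module.forall_dual_apply_eq_zero_iff ℝ _).1 fun φ => ?_
  have := h (φ - φ x • β) (by simp [hβ])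
  simp at this
  simp
  linarith

/-- Polarisation: the cubic form determines the symmetric trilinear map. -/
theorem eq_zero_of_cubic {T : E →ₗ[ℝ] E →ₗ[ℝ] Module.End ℝ E}
    (h1 : ∀ x y z, T x y z = T y x z) (h2 : ∀ x y z, T x y z = T x z y)
    (h : ∀ x, T x x x = 0) : T = 0 := by
  have key : ∀ x y z, (6 : ℝ) • T x y z = 0 := fun x y z => by
    have e : (6 : ℝ) • T x y z = T (x + y + z) (x + y + z) (x + y + z)
        - T (x + y) (x + y) (x + y) - T (x + z) (x + z) (x + z) - T (y + z) (y + z) (y + z)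
        + T x x x + T y y y + T z z z := by
      have e1 : T x z y = T x y z := (h2 _ _ _).symm
      have e2 : T y x z = T x y z := (h1 _ _ _).symm
      have e3 : T y z x = T x y z := by rw [h2, e2]
      have e4 : T z x y = T x y z := by rw [h1, e1]
      have e5 : T z y x = T x y z := by rw [h1, e3]
      simp only [map_add, LinearMap.add_apply, e1, e2, e3, e4, e5]
      module
    rw [e]
    simp only [h, sub_zero, add_zero]
  ext x y z
  simpa using key x y z

/-- The hypothesis makes every x an eigenvector: T(x, x, x) = l x. Varying x to first order, 3 T(x,
x, ·) - l has image in the line of x, and comparing traces gives l (dim E + 2) = 0. -/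
theorem eq_zero_of_traceless [FiniteDimensional ℝ E] {T : E →ₗ[ℝ] E →ₗ[ℝ] Module.End ℝ E}
    (h1 : ∀ x y z, T x y z = T y x z) (h2 : ∀ x y z, T x y z = T x z y)
    (htr : ∀ x y, LinearMap.trace ℝ E (T x y) = 0)
    (h : ∀ (α : E →ₗ[ℝ] ℝ) e, α e = 0 → α (T e e e) = 0) : T = 0 := by
  refine eq_zero_of_cubic h1 h2 fun x => ?_
  by_cases hx : x = 0
  · simp [hx]
  obtain ⟨β, hβ⟩ := exists_dual_eq_one hx
  have hT : T x x x = β (T x x x) • x := eq_smul_of_dual hβ fun α hα => h α x hα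
  have key' : ∀ (α : E →ₗ[ℝ] ℝ) (y : E), α x = 0 → β y = 0 →
      3 * α (T x x y) = α y * β (T x x x) := by
    intro α y hα hy
    -- The functional is corrected by β so that it still annihilates x + t y.
    have hP : ∀ t : ℝ, (α - (t * α y) • β) (T (x + t • y) (x + t • y) (x + t • y)) = 0 := fun t =>
      h _ _ (by simp [hα, hy, hβ])
    have e1 : T x y x = T x x y := h2 _ _ _
    have e2 : T y x x = T x x y := by rw [h1, h2]
    have e3 : T y x y = T x y y := h1 _ _ _
    have e4 : T y y x = T x y y := by rw [h2, h1]
    have a0 := h α x hα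
    have p1 := hP 1
    have p2 := hP (-1)
    have p3 := hP 2
    have p4 := hP (-2)
    simp only [map_add, map_smul, LinearMap.add_apply, LinearMap.smul_apply, LinearMap.sub_apply,
      smul_eq_mul, e1, e2, e3, e4, a0] at p1 p2 p3 p4
    -- The expression is a quartic polynomial in t; this combination of its values at ±1 and ±2
    -- extracts the linear coefficient.
    linear_combination (8 * (p1 - p2) - (p3 - p4)) / 12
  have key : ∀ (α : E →ₗ[ℝ] ℝ) (y : E), α x = 0 → 3 * α (T x x y) = α y * β (T x x x) := by
    intro α y hα
    have := key' α (y - β y • x) hα (by simp [hβ])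
    simpa [hα, h α x hα] using this
  set l := β (T x x x) with hl
  let η : E →ₗ[ℝ] ℝ := β ∘ₗ ((3 : ℝ) • T x x - l • (1 : Module.End ℝ E))
  have hD : (3 : ℝ) • T x x - l • (1 : Module.End ℝ E) = η.smulRight x := by
    ext y
    refine eq_smul_of_dual hβ fun α hα => ?_
    have := key α y hα
    simp
    linarith
  have ht := congrArg (LinearMap.trace ℝ E) hD
  rw [map_sub, map_smul, map_smul, htr, LinearMap.trace_one, LinearMap.trace_smulRight] at ht
  -- Here η(x) = 3 l - l, while the trace of the left side of `hD` is -l dim E.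
  have hη : η x = 2 * l := by
    simp [η, hβ, ← hl]
    ring
  rw [hη] at ht
  have hl0 : l * (Module.finrank ℝ E + 2) = 0 := by
    simp at ht
    linarith
  have : l = 0 := (mul_eq_zero.1 hl0).resolve_right (by positivity)
  rw [hT, this, zero_smul]

theorem exists_combination {M : Type*} [AddCommGroup M] [Module ℝ M] {f g : M →ₗ[ℝ] ℝ} {a b : M}
    (ha : f a ≠ 0) (hb : g b ≠ 0) : ∃ r s : ℝ, f (r • a + s • b) ≠ 0 ∧ g (r • a + s • b) ≠ 0 := by
  by_cases h1 : g a = 0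
  · by_cases h2 : f b = 0
    · exact ⟨1, 1, by simp [h2, ha], by simp [h1, hb]⟩
    · exact ⟨0, 1, by simp [h2], by simp [hb]⟩
  · exact ⟨1, 0, by simp [ha], by simp [h1]⟩

/-- Two nonzero nilpotent rank one operators are linked by a third in general position. -/
theorem exists_link {α α' : E →ₗ[ℝ] ℝ} {e e' : E} (hα : α ≠ 0) (hα' : α' ≠ 0)
    (he : e ≠ 0) (he' : e' ≠ 0) (h : α e = 0) (h' : α' e' = 0) :
    ∃ (β : E →ₗ[ℝ] ℝ) (g : E), β g = 0 ∧ α g ≠ 0 ∧ α' g ≠ 0 ∧ β e ≠ 0 ∧ β e' ≠ 0 := by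
  obtain ⟨a, ha⟩ : ∃ a, α a ≠ 0 := by
    by_contra! hc; exact hα (LinearMap.ext hc)
  obtain ⟨b, hb⟩ : ∃ b, α' b ≠ 0 := by
    by_contra! hc; exact hα' (LinearMap.ext hc)
  obtain ⟨r, s, h1, h2⟩ := exists_combination ha hb
  set g := r • a + s • b
  obtain ⟨δ, hδ⟩ := exists_dual_eq_one he
  obtain ⟨δ', hδ'⟩ := exists_dual_eq_one he'
  -- Subtracting a multiple of α makes δ vanish at g without changing its value at e, because α(e) =
  -- 0.
  have k1 : (δ - (δ g / α g) • α) g = 0 := by simp [h1]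
  have k2 : (δ' - (δ' g / α' g) • α') g = 0 := by simp [h2]
  have k3 : Module.Dual.eval ℝ E e (δ - (δ g / α g) • α) ≠ 0 := by
    simp [h, hδ]
  have k4 : Module.Dual.eval ℝ E e' (δ' - (δ' g / α' g) • α') ≠ 0 := by
    simp [h', hδ']
  obtain ⟨u, v, h3, h4⟩ := exists_combination k3 k4
  refine ⟨u • (δ - (δ g / α g) • α) + v • (δ' - (δ' g / α' g) • α'), g, ?_, h1, h2, h3, h4⟩
  rw [LinearMap.add_apply, LinearMap.smul_apply, LinearMap.smul_apply, k1, k2]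
  simp

end Trilinear

/-! ### Irreducibility of the Ricci-flat curvature tensors of type `aut(H)` -/

section

variable {J : Fin 3 → Module.End ℝ V} {E : Type*} [AddCommGroup E] [Module ℝ E]

/-- The map `f ↦ p ∘ f ∘ i` on endomorphisms. -/
def compress (p : V →ₗ[ℝ] E) (i : E →ₗ[ℝ] V) : Module.End ℝ V →ₗ[ℝ] Module.End ℝ E where
  toFun f := p ∘ₗ f ∘ₗ i
  map_add' f g := by ext; simp
  map_smul' c f := by ext; simp

@[simp] theorem compress_apply (p : V →ₗ[ℝ] E) (i : E →ₗ[ℝ] V) (f : Module.End ℝ V) (x : E) :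
    compress p i f x = p (f (i x)) := rfl

/-- The trilinear map `A ∘ R(A X, A Y) ∘ A`. -/
def sandwich (A : Module.End ℝ V) (R : Tens V) : Tens V :=
  (R.compl₁₂ A A).compr₂ (compress A A)

@[simp] theorem sandwich_apply (A : Module.End ℝ V) (R : Tens V) (X Y Z : V) :
    sandwich A R X Y Z = A (R (A X) (A Y) (A Z)) := rfl

/-- A acts through four commuting slots, one output and three inputs with sign -1, each squaring to
zero. Hence the fourth power of the action is 4! (-1)³ times the simultaneous action on all slots.
-/
theorem sandwich_mem {𝔞 : LieSubalgebra ℝ (Module.End ℝ V)} {q : Submodule ℝ (Tens V)}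
    (hq : Invariant 𝔞 q) {A : Module.End ℝ V} (hA : A ∈ 𝔞) (h0 : ∀ x, A (A x) = 0) {R : Tens V}
    (hR : R ∈ q) : sandwich A R ∈ q := by
  have e2 : ∀ (S : Tens V) (X Y Z : V), ⁅A, ⁅A, S⁆⁆ X Y Z = (2 : ℝ) • (S (A X) (A Y) Z +
      S (A X) Y (A Z) + S X (A Y) (A Z) - A (S X Y (A Z)) - A (S (A X) Y Z) -
      A (S X (A Y) Z)) := fun S X Y Z => by
    simp only [lie_tens_apply, map_sub, h0, map_zero, LinearMap.zero_apply]
    module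
  have e : sandwich A R = (-(1 / 24) : ℝ) • ⁅A, ⁅A, ⁅A, ⁅A, R⁆⁆⁆⁆ := by
    ext X Y Z
    simp only [LinearMap.smul_apply, e2, sandwich_apply, map_sub, map_add, map_smul, h0, map_zero,
      LinearMap.zero_apply]
    module
  rw [e]
  exact q.smul_mem _ (hq A hA _ (hq A hA _ (hq A hA _ (hq A hA _ hR))))

namespace Splitting

variable (S : Splitting J E)

theorem tens_ext {R R' : Tens V} (h : ∀ i j k x y z, R (S.emb i x) (S.emb j y) (S.emb k z) =
    R' (S.emb i x) (S.emb j y) (S.emb k z)) : R = R' :=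
  S.hom_ext fun i x => S.hom_ext fun j y => S.hom_ext fun k z => h i j k x y z

/-- The trilinear map on `E` that represents a curvature tensor of type `aut(H)`. -/
def tri : Tens V →ₗ[ℝ] E →ₗ[ℝ] E →ₗ[ℝ] Module.End ℝ E where
  toFun R := (R.compl₁₂ (S.emb 0) (S.emb 1)).compr₂ (compress (S.coord 0) (S.emb 0))
  map_add' R R' := by ext; simp
  map_smul' c R := by ext; simp

@[simp] theorem tri_apply (R : Tens V) (x y z : E) :
    S.tri R x y z = S.coord 0 (R (S.emb 0 x) (S.emb 1 y) (S.emb 0 z)) := rfl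

theorem autH_emb {L : Module.End ℝ V} (hL : L ∈ autH J) (i : Fin 2) (x : E) :
    L (S.emb i x) = S.emb i (S.coord 0 (L (S.emb 0 x))) := by
  conv_lhs => rw [← S.exists_lift_eq hL]
  rw [S.lift_emb]
  rfl

section

variable {R : Tens V} (hR : R ∈ curv (autH J))
include hR

/-- Choose the third vector in the other copy of E. Values in aut(H) preserve the copies, so in the
Bianchi identity only one term has a component there. -/
theorem curv_emb_same (i : Fin 2) (x y : E) : R (S.emb i x) (S.emb i y) = 0 := by
  have key : ∀ i j, i ≠ j → R (S.emb i x) (S.emb i y) = 0 := by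
    intro i j hij
    have h : ∀ z, S.coord 0 (R (S.emb i x) (S.emb i y) (S.emb 0 z)) = 0 := fun z => by
      have h1 := congrArg (S.coord j) (hR.2.2 (S.emb i x) (S.emb i y) (S.emb j z))
      rw [S.autH_emb (hR.2.1 _ _) j, S.autH_emb (hR.2.1 _ _) i, S.autH_emb (hR.2.1 _ _) i] at h1
      simpa [S.coord_emb, hij.symm] using h1
    exact S.hom_ext fun k z => by
      rw [S.autH_emb (hR.2.1 _ _), h, map_zero, LinearMap.zero_apply]
  fin_cases i
  · exact key 0 1 (by decide)
  · exact key 1 0 (by decide)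

theorem curv_emb (k : Fin 2) (x y z : E) :
    R (S.emb 0 x) (S.emb 1 y) (S.emb k z) = S.emb k (S.tri R x y z) :=
  S.autH_emb (hR.2.1 _ _) k z

theorem curv_emb' (k : Fin 2) (x y z : E) :
    R (S.emb 1 x) (S.emb 0 y) (S.emb k z) = -S.emb k (S.tri R y x z) := by
  rw [curv_neg hR, LinearMap.neg_apply, S.curv_emb hR]

theorem tri_swap₂₃ (x y z : E) : S.tri R x y z = S.tri R x z y := by
  have h := congrArg (S.coord 1) (hR.2.2 (S.emb 0 x) (S.emb 1 y) (S.emb 1 z))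
  rw [S.curv_emb hR, S.curv_emb_same hR, S.curv_emb' hR] at h
  simp only [map_add, map_neg, coord_emb_self, LinearMap.zero_apply, map_zero, add_zero] at h
  exact eq_of_sub_eq_zero (by rw [sub_eq_add_neg]; exact h)

theorem tri_swap₁₃ (x y z : E) : S.tri R x y z = S.tri R z y x := by
  have h := congrArg (S.coord 0) (hR.2.2 (S.emb 0 x) (S.emb 1 y) (S.emb 0 z))
  rw [S.curv_emb hR, S.curv_emb_same hR, S.curv_emb' hR] at h
  simp only [map_add, map_neg, coord_emb_self, LinearMap.zero_apply, map_zero, add_zero] at h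
  exact eq_of_sub_eq_zero (by rw [sub_eq_add_neg]; exact h)

theorem tri_swap₁₂ (x y z : E) : S.tri R x y z = S.tri R y x z := by
  rw [S.tri_swap₁₃ hR, S.tri_swap₂₃ hR, S.tri_swap₁₃ hR]

theorem eq_zero_of_tri (h : S.tri R = 0) : R = 0 := by
  refine S.tens_ext fun i j k x y z => ?_
  fin_cases i <;> fin_cases j
  · simp [S.curv_emb_same hR]
  · simp only [Fin.zero_eta, Fin.mk_one, S.curv_emb hR, h]; simp
  · simp only [Fin.zero_eta, Fin.mk_one, S.curv_emb' hR, h]; simp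
  · simp [S.curv_emb_same hR]

end

theorem trace_tri [FiniteDimensional ℝ V] [FiniteDimensional ℝ E] {R : Tens V}
    (hR : R ∈ weylH J) (x y : E) : LinearMap.trace ℝ E (S.tri R x y) = 0 := by
  have h0 : ric R (S.emb 1 x) (S.emb 0 y) = 0 := LinearMap.congr_fun₂ hR.2 _ _
  have e : (R.flip (S.emb 1 x)).flip (S.emb 0 y) = S.emb 0 ∘ₗ (S.tri R x y ∘ₗ S.coord 0) := by
    refine S.hom_ext fun k z => ?_
    fin_cases k
    · simp only [Fin.zero_eta, LinearMap.flip_apply, S.curv_emb hR.1, LinearMap.comp_apply,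
        coord_emb_self]
      rw [S.tri_swap₁₃ hR.1, S.tri_swap₁₂ hR.1]
    · simp [S.curv_emb_same hR.1]
  rw [ric_apply, e, LinearMap.trace_comp_comm'] at h0
  rw [← h0]
  congr 1
  ext z
  simp

/-- The curvature tensor `(α ⊗ α ⊗ α) ⊗ e`. -/
noncomputable def pureTens (α : E →ₗ[ℝ] ℝ) (e : E) : Tens V :=
  (S.hermOf (α.smulRight α)).compr₂ (LinearMap.toSpanSingleton ℝ _ (S.lift (α.smulRight e)))

theorem pureTens_apply (α : E →ₗ[ℝ] ℝ) (e : E) (X Y Z : V) : S.pureTens α e X Y Z =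
    (α (S.coord 0 X) * α (S.coord 1 Y) - α (S.coord 1 X) * α (S.coord 0 Y)) •
      S.lift (α.smulRight e) Z := by
  simp [pureTens, hermOf]

theorem pureTens_ne_zero {α : E →ₗ[ℝ] ℝ} {e : E} (hα : α ≠ 0) (he : e ≠ 0) :
    S.pureTens α e ≠ 0 := by
  obtain ⟨a, ha⟩ : ∃ a, α a ≠ 0 := by
    by_contra! hc; exact hα (LinearMap.ext hc)
  intro h
  have := congrArg (S.coord 0)
    (LinearMap.congr_fun (LinearMap.congr_fun₂ h (S.emb 0 a) (S.emb 1 a)) (S.emb 0 a))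
  simp [pureTens_apply, ha, he] at this

theorem tri_pureTens (α : E →ₗ[ℝ] ℝ) (e x y z : E) :
    S.tri (S.pureTens α e) x y z = (α x * α y * α z) • e := by
  simp [pureTens_apply, smul_smul]

/-- Every argument is replaced by a multiple of e, so only the number α(T(e, e, e)) of R survives.
-/
theorem sandwich_lift {R : Tens V} (hR : R ∈ curv (autH J)) (α : E →ₗ[ℝ] ℝ) (e : E) :
    sandwich (S.lift (α.smulRight e)) R = α (S.tri R e e e) • S.pureTens α e := by
  refine S.tens_ext fun i j k x y z => ?_
  rw [sandwich_apply, LinearMap.smul_apply, LinearMap.smul_apply, LinearMap.smul_apply,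
    pureTens_apply]
  simp only [S.lift_emb, LinearMap.smulRight_apply, map_smul, LinearMap.smul_apply]
  fin_cases i <;> fin_cases j
  · simp [S.curv_emb_same hR]
  · simp only [Fin.zero_eta, Fin.mk_one, S.curv_emb hR, S.lift_emb, LinearMap.smulRight_apply,
      coord_emb_self, coord_zero_emb_one, coord_one_emb_zero, map_zero, map_smul]
    module
  · simp only [Fin.zero_eta, Fin.mk_one, S.curv_emb' hR, S.lift_emb, LinearMap.smulRight_apply,
      coord_emb_self, coord_zero_emb_one, coord_one_emb_zero, map_zero, map_smul, map_neg]
    module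
  · simp [S.curv_emb_same hR]

theorem pureTens_mem {q : Submodule ℝ (Tens V)} (hq : Invariant (autH J) q)
    {R : Tens V} (hR : R ∈ curv (autH J)) (hRq : R ∈ q) {α : E →ₗ[ℝ] ℝ} {e : E} (h0 : α e = 0)
    (h : α (S.tri R e e e) ≠ 0) : S.pureTens α e ∈ q := by
  have := sandwich_mem hq (S.lift_mem_autH (α.smulRight e)) (fun x => by
    rw [← Module.End.mul_apply, ← S.lift_mul]
    have : α.smulRight e * α.smulRight e = 0 := by ext; simp [h0]
    rw [this]
    simp [lift]) hRq
  rw [S.sandwich_lift hR] at this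
  exact (q.smul_mem_iff h).1 this

theorem exists_pureTens_mem [FiniteDimensional ℝ V] [FiniteDimensional ℝ E]
    {q : Submodule ℝ (Tens V)} (hq : Invariant (autH J) q) (hle : q ≤ weylH J) (h0 : q ≠ ⊥) :
    ∃ (α : E →ₗ[ℝ] ℝ) (e : E), α e = 0 ∧ α ≠ 0 ∧ e ≠ 0 ∧ S.pureTens α e ∈ q := by
  obtain ⟨R, hR, hR0⟩ := (Submodule.ne_bot_iff q).1 h0
  have hc := (hle hR).1
  by_contra! hcon
  refine hR0 (S.eq_zero_of_tri hc (eq_zero_of_traceless (S.tri_swap₁₂ hc) (S.tri_swap₂₃ hc)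
    (S.trace_tri (hle hR)) fun α e hαe => ?_))
  by_contra hne
  refine hcon α e hαe ?_ ?_ (S.pureTens_mem hq hc hR hαe hne)
  · rintro rfl; exact hne rfl
  · rintro rfl; exact hne (by simp)

/-- Passing through β³ ⊗ g: the factors met are α(g)³ β(e) and β(e')³ α'(g), nonzero by the choice
of the link. -/
theorem pureTens_mem_of_pureTens_mem {q : Submodule ℝ (Tens V)} (hq : Invariant (autH J) q)
    (hle : q ≤ curv (autH J)) {α α' : E →ₗ[ℝ] ℝ} {e e' : E} (hα : α ≠ 0) (hα' : α' ≠ 0)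
    (he : e ≠ 0) (he' : e' ≠ 0) (h : α e = 0) (h' : α' e' = 0) (hm : S.pureTens α e ∈ q) :
    S.pureTens α' e' ∈ q := by
  obtain ⟨β, g, h1, h2, h3, h4, h5⟩ := exists_link hα hα' he he' h h'
  have hm1 : S.pureTens β g ∈ q := S.pureTens_mem hq (hle hm) hm h1 (by
    simp [-tri_apply, tri_pureTens, h2, h4])
  exact S.pureTens_mem hq (hle hm1) hm1 h' (by simp [-tri_apply, tri_pureTens, h3, h5])

theorem tri_lie (A : Module.End ℝ E) (R : Tens V) (x y z : E) : S.tri ⁅S.lift A, R⁆ x y z =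
    A (S.tri R x y z) - S.tri R x y (A z) - S.tri R (A x) y z - S.tri R x (A y) z := by
  have h : ∀ X, S.coord 0 (S.lift A X) = A (S.coord 0 X) := fun X => by simp [lift]
  simp only [tri_apply, lie_tens_apply, map_sub, h, S.lift_emb]

end Splitting

end

/-! ### The invariant inner product -/

section

variable {J : Fin 3 → Module.End ℝ V} {E : Type*} [NormedAddCommGroup E] [InnerProductSpace ℝ E]

/-- The inner product of trilinear maps. -/
noncomputable def triForm {ι : Type*} [Fintype ι] (b : OrthonormalBasis ι ℝ E)
    (T T' : E →ₗ[ℝ] E →ₗ[ℝ] Module.End ℝ E) : ℝ :=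
  ∑ r, ∑ s, ∑ t, inner ℝ (T (b r) (b s) (b t)) (T' (b r) (b s) (b t))

theorem triForm_self {ι : Type*} [Fintype ι] {b : OrthonormalBasis ι ℝ E}
    {T : E →ₗ[ℝ] E →ₗ[ℝ] Module.End ℝ E} (h : triForm b T T = 0) : T = 0 := by
  have hn : ∀ r s t, (0 : ℝ) ≤ inner ℝ (T (b r) (b s) (b t)) (T (b r) (b s) (b t)) :=
    fun _ _ _ => real_inner_self_nonneg
  have h0 : ∀ r s t, T (b r) (b s) (b t) = 0 := by
    intro r s t
    have h1 := (Finset.sum_eq_zero_iff_of_nonneg (fun r _ => Finset.sum_nonneg fun s _ =>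
      Finset.sum_nonneg fun t _ => hn r s t)).1 h r (Finset.mem_univ _)
    have h2 := (Finset.sum_eq_zero_iff_of_nonneg (fun s _ =>
      Finset.sum_nonneg fun t _ => hn r s t)).1 h1 s (Finset.mem_univ _)
    have h3 := (Finset.sum_eq_zero_iff_of_nonneg (fun t _ => hn r s t)).1 h2 t (Finset.mem_univ _)
    exact inner_self_eq_zero.1 h3
  refine b.toBasis.ext fun r => b.toBasis.ext fun s => b.toBasis.ext fun t => ?_
  simpa using h0 r s t

variable [FiniteDimensional ℝ E]

/-- Moves an operator across a sum over an orthonormal basis; in `triForm_adjoint` it is applied to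
each of the three arguments. -/
theorem sum_adjoint {ι : Type*} [Fintype ι] (b : OrthonormalBasis ι ℝ E) (A : Module.End ℝ E)
    (β : Bil E) : ∑ r, β (A (b r)) (b r) = ∑ r, β (b r) (LinearMap.adjoint A (b r)) := by
  have h1 : ∀ r, β (A (b r)) (b r) = ∑ s, inner ℝ (b s) (A (b r)) * β (b s) (b r) := fun r => by
    conv_lhs => rw [← b.sum_repr' (A (b r))]
    simp
  have h2 : ∀ s, β (b s) (LinearMap.adjoint A (b s)) =
      ∑ r, inner ℝ (b s) (A (b r)) * β (b s) (b r) := fun s => by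
    conv_lhs => rw [← b.sum_repr' (LinearMap.adjoint A (b s))]
    simp [LinearMap.adjoint_inner_right, real_inner_comm]
  simp only [h1, h2]
  exact Finset.sum_comm

/-- The transpose of the action of A is the action of the adjoint of A, so orthogonal complements of
gl(E)-invariant subspaces are invariant. -/
theorem triForm_adjoint {ι : Type*} [Fintype ι] (b : OrthonormalBasis ι ℝ E) (A : Module.End ℝ E)
    {T T' T₁ T₂ : E →ₗ[ℝ] E →ₗ[ℝ] Module.End ℝ E}
    (h1 : ∀ x y z, T₁ x y z = A (T x y z) - T x y (A z) - T (A x) y z - T x (A y) z)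
    (h2 : ∀ x y z, T₂ x y z = LinearMap.adjoint A (T' x y z) - T' x y (LinearMap.adjoint A z) -
      T' (LinearMap.adjoint A x) y z - T' x (LinearMap.adjoint A y) z) :
    triForm b T₁ T' = triForm b T T₂ := by
  let d : Bil E := innerₗ E
  have hd : ∀ x y, d x y = inner ℝ x y := fun _ _ => rfl
  have e3 : ∀ r s, ∑ t, d (T (b r) (b s) (A (b t))) (T' (b r) (b s) (b t)) =
      ∑ t, d (T (b r) (b s) (b t)) (T' (b r) (b s) (LinearMap.adjoint A (b t))) := fun r s =>
    sum_adjoint b A (d.compl₁₂ (T (b r) (b s)) (T' (b r) (b s)))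
  have e2 : ∀ r, ∑ s, ∑ t, d (T (b r) (A (b s)) (b t)) (T' (b r) (b s) (b t)) =
      ∑ s, ∑ t, d (T (b r) (b s) (b t)) (T' (b r) (LinearMap.adjoint A (b s)) (b t)) := fun r => by
    simpa using sum_adjoint b A (∑ t, d.compl₁₂ ((T (b r)).flip (b t)) ((T' (b r)).flip (b t)))
  have e1 : ∑ r, ∑ s, ∑ t, d (T (A (b r)) (b s) (b t)) (T' (b r) (b s) (b t)) =
      ∑ r, ∑ s, ∑ t, d (T (b r) (b s) (b t)) (T' (LinearMap.adjoint A (b r)) (b s) (b t)) := by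
    simpa using sum_adjoint b A
      (∑ s, ∑ t, d.compl₁₂ ((T.flip (b s)).flip (b t)) ((T'.flip (b s)).flip (b t)))
  simp only [triForm, h1, h2, inner_sub_left, inner_sub_right, Finset.sum_sub_distrib]
  simp only [← hd] at e1 e2 e3 ⊢
  simp only [e1, e2, e3]
  simp only [hd, LinearMap.adjoint_inner_right]

theorem weylH_isMinimal [FiniteDimensional ℝ V] (S : Splitting J E) (h0 : weylH J ≠ ⊥) :
    IsMinimal (autH J) (weylH J) := by
  refine ⟨h0, fun q hle hq hq0 => ?_⟩
  obtain ⟨α, e, hαe, hα, he, hm⟩ := S.exists_pureTens_mem hq hle hq0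
  let b := stdOrthonormalBasis ℝ E
  let F : LinearMap.BilinForm ℝ (Tens V) := LinearMap.mk₂ ℝ
    (fun R R' => triForm b (S.tri R) (S.tri R'))
    (fun _ _ _ => by
      simp only [triForm, map_add, LinearMap.add_apply, inner_add_left, Finset.sum_add_distrib])
    (fun _ _ _ => by
      simp only [triForm, map_smul, LinearMap.smul_apply, inner_smul_left, ← Finset.mul_sum]; rfl)
    (fun _ _ _ => by
      simp only [triForm, map_add, LinearMap.add_apply, inner_add_right, Finset.sum_add_distrib])
    (fun _ _ _ => by
      simp only [triForm, map_smul, LinearMap.smul_apply, inner_smul_right, ← Finset.mul_sum]; rfl)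
  have hF : ∀ R R', F R R' = triForm b (S.tri R) (S.tri R') := fun _ _ => rfl
  have hsymm : ∀ R R', F R R' = F R' R := fun R R' => by
    simp only [hF, triForm, real_inner_comm]
  have hdef : ∀ R ∈ weylH J, F R R = 0 → R = 0 := fun R hR h =>
    S.eq_zero_of_tri hR.1 (triForm_self ((hF R R).symm.trans h))
  -- F sees only one block of a tensor and need not be definite on all tensors. Definiteness on
  -- `weylH J` makes its restriction to q nondegenerate, which is enough.
  have hcompl : IsCompl q (F.orthogonal q) := by
    refine LinearMap.BilinForm.isCompl_orthogonal_of_restrict_nondegenerate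
      (fun R R' h => by rw [hsymm]; exact h) ⟨fun R h => ?_, fun R h => ?_⟩
    · exact Subtype.ext (hdef _ (hle R.2) (h R))
    · exact Subtype.ext (hdef _ (hle R.2) (h R))
  have hinv : Invariant (autH J) (F.orthogonal q ⊓ weylH J) := by
    rintro L hL R ⟨hR, hRw⟩
    refine ⟨fun Q hQ => ?_, weylH_invariant L hL R hRw⟩
    rw [← S.exists_lift_eq hL]
    set A : Module.End ℝ E := S.coord 0 ∘ₗ L ∘ₗ S.emb 0
    have h1 : F ⁅S.lift (LinearMap.adjoint A), Q⁆ R = 0 :=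
      hR _ (hq _ (S.lift_mem_autH _) _ hQ)
    change F Q ⁅S.lift A, R⁆ = 0
    rw [← h1, hF, hF]
    refine (triForm_adjoint b (LinearMap.adjoint A) (S.tri_lie _ Q) fun x y z => ?_).symm
    rw [LinearMap.adjoint_adjoint]
    exact S.tri_lie A R x y z
  -- Otherwise the complement would also contain α³ ⊗ e, which would then be orthogonal to itself.
  have hbot : F.orthogonal q ⊓ weylH J = ⊥ := by
    by_contra hne
    obtain ⟨α', e', hαe', hα', he', hm'⟩ := S.exists_pureTens_mem hinv inf_le_right hne
    have := S.pureTens_mem_of_pureTens_mem hinv (inf_le_right.trans inf_le_left) hα' hα he' he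
      hαe' hαe hm'
    exact S.pureTens_ne_zero hα he (hdef _ (hle hm) (this.1 _ hm))
  intro R hR
  obtain ⟨Q, hQ, P, hP, rfl⟩ : ∃ Q ∈ q, ∃ P ∈ F.orthogonal q, Q + P = R := by
    rw [← Submodule.mem_sup, hcompl.sup_eq_top]
    trivial
  have hPw : P ∈ weylH J := by
    have := sub_mem hR (hle hQ)
    rwa [add_sub_cancel_left] at this
  have : P ∈ F.orthogonal q ⊓ weylH J := ⟨hP, hPw⟩
  rw [hbot, Submodule.mem_bot] at this
  rwa [this, add_zero]

end

/-! ### The component of a Ricci-flat curvature tensor in `G` -/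

section

variable {G : LieSubalgebra ℝ (Module.End ℝ V)} {J : Fin 3 → Module.End ℝ V}

/-- The coefficient of `J a` in a curvature tensor of type `aut(G)`. -/
noncomputable def omega (J : Fin 3 → Module.End ℝ V) (R : Tens V) (a : Fin 3) : Bil V :=
  R.compr₂ ((-(eps a / Module.finrank ℝ V)) • (LinearMap.trace ℝ V ∘ₗ LinearMap.mulLeft ℝ (J a)))

theorem omega_apply (R : Tens V) (a : Fin 3) (X Y : V) : omega J R a X Y =
    -(eps a / Module.finrank ℝ V) * LinearMap.trace ℝ V (J a * R X Y) := rfl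

theorem eps_mul_self (a : Fin 3) : eps a * eps a = 1 := by fin_cases a <;> simp

theorem trace_J_mul_eq [FiniteDimensional ℝ V] [Nontrivial V] (R : Tens V) (a : Fin 3) (X Y : V) :
    LinearMap.trace ℝ V (J a * R X Y) = -(eps a * Module.finrank ℝ V * omega J R a X Y) := by
  have hd : (Module.finrank ℝ V : ℝ) ≠ 0 := by exact_mod_cast Module.finrank_pos.ne'
  rw [omega_apply]
  field_simp
  linear_combination (-LinearMap.trace ℝ V (J a * R X Y)) * eps_mul_self a

theorem sub_omega_mem [FiniteDimensional ℝ V] (h : Corresponds G J) {R : Tens V}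
    (hR : R ∈ curv (autG G)) (X Y : V) : R X Y - ∑ a, omega J R a X Y • J a ∈ autH J := by
  have := h.nontrivial
  have hd : (Module.finrank ℝ V : ℝ) ≠ 0 := by exact_mod_cast Module.finrank_pos.ne'
  obtain ⟨A, hA, c, hc⟩ := h.autG_decomp (hR.2.1 X Y)
  have e : ∀ a, omega J R a X Y = c a := fun a => by
    rw [omega_apply, hc, h.parahypercomplex.trace_mul_add hA]
    field_simp
    linear_combination c a * eps_mul_self a
  simp only [e]
  rwa [hc, add_sub_cancel_right]

theorem omega_swap {A : LieSubalgebra ℝ (Module.End ℝ V)} {R : Tens V} (hR : R ∈ curv A)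
    (a : Fin 3) (X Y : V) : omega J R a X Y = -omega J R a Y X := by
  rw [omega_apply, omega_apply, curv_neg hR, mul_neg, map_neg]
  ring

/-- The traced Bianchi identity with K = J_a. Moving J_a past R costs commutators that involve only
the other two coefficients, and the remaining trace is a value of Ric, hence zero. -/
theorem omega_equations [FiniteDimensional ℝ V] (h : Corresponds G J) {R : Tens V}
    (hR : R ∈ weyl G) (X Y : V) :
    -(Module.finrank ℝ V * omega J R 0 X Y) =
      2 * (omega J R 1 (J 2 X) Y + omega J R 1 X (J 2 Y)) -
      2 * (omega J R 2 (J 1 X) Y + omega J R 2 X (J 1 Y)) ∧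
    Module.finrank ℝ V * omega J R 1 X Y =
      -2 * (omega J R 0 (J 2 X) Y + omega J R 0 X (J 2 Y)) -
      2 * (omega J R 2 (J 0 X) Y + omega J R 2 X (J 0 Y)) ∧
    Module.finrank ℝ V * omega J R 2 X Y =
      2 * (omega J R 0 (J 1 X) Y + omega J R 0 X (J 1 Y)) +
      2 * (omega J R 1 (J 0 X) Y + omega J R 1 X (J 0 Y)) := by
  have := h.nontrivial
  have hp := h.parahypercomplex
  have hc : R ∈ curv (autG G) := hR.1
  have hr : ∀ Y Z, LinearMap.trace ℝ V ((R.flip Y).flip Z) = 0 := fun Y Z =>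
    LinearMap.congr_fun₂ hR.2 Y Z
  have hcomm : ∀ a X Y Z, R X Y (J a Z) = J a (R X Y Z) +
      ∑ b, omega J R b X Y • (J b (J a Z) - J a (J b Z)) := by
    intro a X Y Z
    have := mem_autH.1 (sub_omega_mem h hc X Y) a Z
    simp only [Fin.sum_univ_three, LinearMap.sub_apply, LinearMap.add_apply, LinearMap.smul_apply,
      map_sub, map_add, map_smul] at this ⊢
    linear_combination (norm := module) this
  have k0 : ∀ X Y, LinearMap.trace ℝ V (J 0 * (R.flip Y).flip X) =
      2 * omega J R 1 (J 2 X) Y - 2 * omega J R 2 (J 1 X) Y := by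
    intro X Y
    have e : J 0 * (R.flip Y).flip X = (R.flip Y).flip (J 0 X) +
        (2 : ℝ) • ((omega J R 1).flip Y).smulRight (J 2 X) -
        (2 : ℝ) • ((omega J R 2).flip Y).smulRight (J 1 X) := by
      ext Z
      simp [hcomm 0, Fin.sum_univ_three, hp.J00, hp.J10, hp.J20, hp.J01, hp.J02]
      module
    rw [e, map_sub, map_add, map_smul, map_smul, LinearMap.trace_smulRight,
      LinearMap.trace_smulRight, hr]
    simp
  have k1 : ∀ X Y, LinearMap.trace ℝ V (J 1 * (R.flip Y).flip X) =
      -2 * omega J R 0 (J 2 X) Y - 2 * omega J R 2 (J 0 X) Y := by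
    intro X Y
    have e : J 1 * (R.flip Y).flip X = (R.flip Y).flip (J 1 X) +
        (-2 : ℝ) • ((omega J R 0).flip Y).smulRight (J 2 X) -
        (2 : ℝ) • ((omega J R 2).flip Y).smulRight (J 0 X) := by
      ext Z
      simp [hcomm 1, Fin.sum_univ_three, hp.J11, hp.J10, hp.J12, hp.J01, hp.J21]
      module
    rw [e, map_sub, map_add, map_smul, map_smul, LinearMap.trace_smulRight,
      LinearMap.trace_smulRight, hr]
    simp
  have k2 : ∀ X Y, LinearMap.trace ℝ V (J 2 * (R.flip Y).flip X) =
      2 * omega J R 0 (J 1 X) Y + 2 * omega J R 1 (J 0 X) Y := by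
    intro X Y
    have e : J 2 * (R.flip Y).flip X = (R.flip Y).flip (J 2 X) +
        (2 : ℝ) • ((omega J R 0).flip Y).smulRight (J 1 X) +
        (2 : ℝ) • ((omega J R 1).flip Y).smulRight (J 0 X) := by
      ext Z
      simp [hcomm 2, Fin.sum_univ_three, hp.J22, hp.J20, hp.J12, hp.J02, hp.J21]
      module
    rw [e, map_add, map_add, map_smul, map_smul, LinearMap.trace_smulRight,
      LinearMap.trace_smulRight, hr]
    simp
  have t0 := trace_mul_curv hc (J 0) X Y
  have t1 := trace_mul_curv hc (J 1) X Y
  have t2 := trace_mul_curv hc (J 2) X Y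
  rw [trace_J_mul_eq, k0, k0, omega_swap hc 1 _ X, omega_swap hc 2 _ X, eps_zero] at t0
  rw [trace_J_mul_eq, k1, k1, omega_swap hc 0 _ X, omega_swap hc 2 _ X, eps_one] at t1
  rw [trace_J_mul_eq, k2, k2, omega_swap hc 0 _ X, omega_swap hc 1 _ X, eps_two] at t2
  exact ⟨by linear_combination t0, by linear_combination t1, by linear_combination t2⟩

/-! ### The linear system for the G-component. -/

/-- The linear system for the components of the forms `ω_a`. -/
structure OmegaSystem (M : ℝ) (a b c : Fin 2 → Fin 2 → ℝ) : Prop where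
  a00 : -(M * a 0 0) = b 1 0 + b 0 1 - 2 * c 0 0
  a01 : -(M * a 0 1) = b 1 1 + b 0 0
  a10 : -(M * a 1 0) = b 0 0 + b 1 1
  a11 : -(M * a 1 1) = b 0 1 + b 1 0 + 2 * c 1 1
  b00 : M * b 0 0 = -(a 1 0 + a 0 1) - (c 1 0 + c 0 1)
  b01 : M * b 0 1 = -(a 1 1 + a 0 0) - (c 1 1 - c 0 0)
  b10 : M * b 1 0 = -(a 0 0 + a 1 1) - (c 1 1 - c 0 0)
  b11 : M * b 1 1 = -(a 0 1 + a 1 0) + (c 0 1 + c 1 0)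
  c00 : M * c 0 0 = 2 * a 0 0 + (b 1 0 + b 0 1)
  c01 : M * c 0 1 = b 1 1 - b 0 0
  c10 : M * c 1 0 = b 1 1 - b 0 0
  c11 : M * c 1 1 = -2 * a 1 1 - (b 0 1 + b 1 0)

theorem OmegaSystem.symm {M : ℝ} {a b c : Fin 2 → Fin 2 → ℝ} (h : OmegaSystem M a b c)
    (hM : M ≠ 0) : a 1 0 = a 0 1 ∧ b 1 0 = b 0 1 ∧ c 1 0 = c 0 1 :=
  ⟨mul_left_cancel₀ hM (by linarith [h.a01, h.a10]),
    mul_left_cancel₀ hM (by linarith [h.b01, h.b10]),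
    mul_left_cancel₀ hM (by linarith [h.c01, h.c10])⟩

/-- Elimination divides by M, M + 2, M - 2, M + 4 and M² - 4. With M = dim V / 2 the value M = 2,
where this fails, is dimension four. -/
theorem OmegaSystem.eq_zero {M : ℝ} {a b c : Fin 2 → Fin 2 → ℝ} (h : OmegaSystem M a b c)
    (hM : 2 < M) (i j : Fin 2) : a i j = 0 ∧ b i j = 0 ∧ c i j = 0 := by
  obtain ⟨sa, sb, sc⟩ := h.symm (by linarith)
  obtain ⟨a00, a01, -, a11, b00, b01, -, b11, c00, c01, -, c11⟩ := h
  rw [sa] at b00 b11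
  rw [sb] at a00 a11 c00 c11
  rw [sc] at b00 b11
  have hM0 : M ≠ 0 := by linarith
  have h4 : M * M - 4 ≠ 0 := by nlinarith
  have h2 : M - 2 ≠ 0 := by linarith
  have z1 : a 0 1 = 0 := (mul_eq_zero.1 (show (M * M - 4) * a 0 1 = 0 by
    linear_combination -M * a01 - b00 - b11)).resolve_left h4
  have z2 : c 0 1 = 0 := (mul_eq_zero.1 (show (M * M - 4) * c 0 1 = 0 by
    linear_combination M * c01 - b00 + b11)).resolve_left h4
  have z3 : b 0 0 = 0 := (mul_eq_zero.1 (show M * b 0 0 = 0 by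
    rw [b00, z1, z2]; ring)).resolve_left hM0
  have z4 : b 1 1 = 0 := (mul_eq_zero.1 (show M * b 1 1 = 0 by
    rw [b11, z1, z2]; ring)).resolve_left hM0
  have u1 : c 0 0 + a 0 0 = 0 := (mul_eq_zero.1 (show (M - 2) * (c 0 0 + a 0 0) = 0 by
    linear_combination c00 - a00)).resolve_left h2
  have u2 : c 1 1 - a 1 1 = 0 := (mul_eq_zero.1 (show (M - 2) * (c 1 1 - a 1 1) = 0 by
    linear_combination c11 + a11)).resolve_left h2
  have v1 : c 0 0 = -a 0 0 := by linarith
  have v2 : c 1 1 = a 1 1 := by linarith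
  rw [v1] at a00 b01
  rw [v2] at a11 b01
  have z5 : b 0 1 = 0 := (mul_eq_zero.1 (show ((M + 4) * (M - 2)) * b 0 1 = 0 by
    linear_combination (M + 2) * b01 + 2 * a00 + 2 * a11)).resolve_left
      (mul_ne_zero (by linarith) h2)
  have z6 : a 0 0 = 0 := (mul_eq_zero.1 (show (M + 2) * a 0 0 = 0 by
    linear_combination -a00 - 2 * z5)).resolve_left (by linarith)
  have z7 : a 1 1 = 0 := (mul_eq_zero.1 (show (M + 2) * a 1 1 = 0 by
    linear_combination -a11 - 2 * z5)).resolve_left (by linarith)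
  fin_cases i <;> fin_cases j <;> simp [*]

variable {E : Type*} [AddCommGroup E] [Module ℝ E]

theorem Splitting.omegaSystem [FiniteDimensional ℝ V] (S : Splitting J E) (h : Corresponds G J)
    {R : Tens V} (hR : R ∈ weyl G) (x y : E) : OmegaSystem (Module.finrank ℝ V / 2)
      (fun i j => omega J R 0 (S.emb i x) (S.emb j y))
      (fun i j => omega J R 1 (S.emb i x) (S.emb j y))
      (fun i j => omega J R 2 (S.emb i x) (S.emb j y)) := by
  have H := fun i j => omega_equations h hR (S.emb i x) (S.emb j y)
  have H00 := H 0 0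
  have H01 := H 0 1
  have H10 := H 1 0
  have H11 := H 1 1
  simp only [S.J0_emb0, S.J0_emb1, S.J1_emb0, S.J1_emb1, S.J2_emb0, S.J2_emb1, map_neg,
    LinearMap.neg_apply] at H00 H01 H10 H11
  constructor <;> linarith

theorem weyl_eq_weylH [FiniteDimensional ℝ V] (S : Splitting J E) (h : Corresponds G J)
    (hV : 4 < Module.finrank ℝ V) : weyl G = weylH J := by
  refine le_antisymm (fun R hR => ?_) (weylH_le_weyl h)
  have hM : (2 : ℝ) < Module.finrank ℝ V / 2 := by
    have : (4 : ℝ) < Module.finrank ℝ V := by exact_mod_cast hV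
    linarith
  have h0 : ∀ a, omega J R a = 0 := fun a => S.bil_ext fun i j x y => by
    have := (S.omegaSystem h hR x y).eq_zero hM i j
    fin_cases a
    · exact this.1
    · exact this.2.1
    · exact this.2.2
  refine ⟨⟨hR.1.1, fun X Y => ?_, hR.1.2.2⟩, hR.2⟩
  simpa [h0] using sub_omega_mem h hR.1 X Y

/-- The cyclic sum is alternating in three vectors of a plane. -/
theorem skew_cyclic_eq_zero [FiniteDimensional ℝ E] (hE : Module.finrank ℝ E = 2) {p : Bil E}
    (hp : ∀ x y, p x y = -p y x) (x y z : E) : p x y • z + p y z • x + p z x • y = 0 := by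
  let b := Module.finBasisOfFinrankEq ℝ E hE
  have h0 : ∀ x, p x x = 0 := fun x => by linarith [hp x x]
  have h1 : p (b 1) (b 0) = -p (b 0) (b 1) := hp _ _
  rw [← b.sum_repr x, ← b.sum_repr y, ← b.sum_repr z]
  simp only [Fin.sum_univ_two, map_add, map_smul, LinearMap.add_apply, LinearMap.smul_apply,
    smul_eq_mul, h0, h1]
  module

/-- The component of a curvature tensor with values in `G`. -/
noncomputable def gPart (J : Fin 3 → Module.End ℝ V) (R : Tens V) : Tens V :=
  ∑ a, (omega J R a).compr₂ (LinearMap.toSpanSingleton ℝ _ (J a))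

theorem gPart_apply (R : Tens V) (X Y : V) : gPart J R X Y = ∑ a, omega J R a X Y • J a := by
  simp [gPart]

theorem gPart_mem_curv [FiniteDimensional ℝ V] (S : Splitting J E) (h : Corresponds G J)
    (hV : Module.finrank ℝ V = 4) {R : Tens V} (hR : R ∈ weyl G) : gPart J R ∈ curv G := by
  have := S.finiteDimensional
  have hE : Module.finrank ℝ E = 2 := by
    have := S.finrank_eq
    omega
  refine ⟨fun X => ?_, fun X Y => ?_, fun X Y Z => ?_⟩
  · have h0 : ∀ a, omega J R a X X = 0 := fun a => by linarith [omega_swap hR.1 a (J := J) X X]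
    simp [gPart_apply, h0]
  · rw [gPart_apply]
    exact h.mem_iff.2 ⟨_, rfl⟩
  -- P and Q are the two ℝ² components of the G-part. At M = 2 the system makes them symmetric in i,
  -- j, k; they are skew in x, y, so Bianchi reduces to `skew_cyclic_eq_zero`.
  let P : Fin 2 → Fin 2 → Fin 2 → Bil E := fun i j k =>
    (![omega J R 1, omega J R 2 - omega J R 0] k).compl₁₂ (S.emb i) (S.emb j)
  let Q : Fin 2 → Fin 2 → Fin 2 → Bil E := fun i j k =>
    (![omega J R 0 + omega J R 2, -omega J R 1] k).compl₁₂ (S.emb i) (S.emb j)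
  have hPQ : ∀ i j k x y z, gPart J R (S.emb i x) (S.emb j y) (S.emb k z) =
      S.emb 0 (P i j k x y • z) + S.emb 1 (Q i j k x y • z) := by
    intro i j k x y z
    rw [gPart_apply]
    fin_cases k <;>
    simp [Fin.sum_univ_three, P, Q, S.J0_emb0, S.J0_emb1, S.J1_emb0, S.J1_emb1, S.J2_emb0,
      S.J2_emb1] <;> module
  have hs := fun x y => S.omegaSystem h hR x y
  have hsymm : ∀ a i j x y, omega J R a (S.emb i x) (S.emb j y) =
      omega J R a (S.emb j x) (S.emb i y) := by
    intro a i j x y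
    obtain ⟨s0, s1, s2⟩ := (hs x y).symm (by rw [hV]; norm_num)
    fin_cases a <;> fin_cases i <;> fin_cases j <;> simp [s0, s1, s2]
  have hP₁₂ : ∀ i j k, P i j k = P j i k := fun i j k => by
    ext x y
    fin_cases k <;> simp [P, hsymm _ i j]
  have hQ₁₂ : ∀ i j k, Q i j k = Q j i k := fun i j k => by
    ext x y
    fin_cases k <;> simp [Q, hsymm _ i j]
  have hPQ₂₃ : ∀ i x y, P i 0 1 x y = P i 1 0 x y ∧ Q i 0 1 x y = Q i 1 0 x y := by
    intro i x y
    have t := hs x y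
    rw [hV] at t
    obtain ⟨a00, a01, a10, a11, b00, b01, b10, b11, c00, c01, c10, c11⟩ := t
    obtain ⟨s0, s1, s2⟩ := (hs x y).symm (by rw [hV]; norm_num)
    push_cast at a00 a01 a10 a11 b00 b01 b10 b11 c00 c01 c10 c11
    fin_cases i <;> simp only [P, Q, Fin.zero_eta, Fin.mk_one, Matrix.cons_val_zero,
      Matrix.cons_val_one, LinearMap.compl₁₂_apply, LinearMap.sub_apply, LinearMap.add_apply,
      LinearMap.neg_apply] <;> constructor <;> linarith
  have hP₂₃ : ∀ i j k, P i j k = P i k j := fun i j k => by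
    ext x y
    fin_cases j <;> fin_cases k <;> simp [hPQ₂₃ i x y]
  have hQ₂₃ : ∀ i j k, Q i j k = Q i k j := fun i j k => by
    ext x y
    fin_cases j <;> fin_cases k <;> simp [hPQ₂₃ i x y]
  have hskew : ∀ a i j x y, omega J R a (S.emb i x) (S.emb j y) =
      -omega J R a (S.emb i y) (S.emb j x) := fun a i j x y => by
    rw [omega_swap hR.1, hsymm]
  have hPs : ∀ i j k x y, P i j k x y = -P i j k y x := fun i j k x y => by
    fin_cases k <;> simp [P, hskew _ i j x y]
    ring
  have hQs : ∀ i j k x y, Q i j k x y = -Q i j k y x := fun i j k x y => by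
    fin_cases k <;> simp [Q, hskew _ i j x y]
    ring
  have key : ∀ i j k x y z, gPart J R (S.emb i x) (S.emb j y) (S.emb k z) +
      gPart J R (S.emb j y) (S.emb k z) (S.emb i x) +
      gPart J R (S.emb k z) (S.emb i x) (S.emb j y) = 0 := by
    intro i j k x y z
    have e1 := congrArg (S.emb 0) (skew_cyclic_eq_zero hE (hPs i j k) x y z)
    have e2 := congrArg (S.emb 1) (skew_cyclic_eq_zero hE (hQs i j k) x y z)
    rw [hPQ, hPQ, hPQ, hP₂₃ j k i, hP₁₂ j i k, hP₁₂ k i j, hP₂₃ i k j, hQ₂₃ j k i, hQ₁₂ j i k,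
      hQ₁₂ k i j, hQ₂₃ i k j]
    simp only [map_add, map_zero] at e1 e2
    linear_combination (norm := module) e1 + e2
  rw [← S.emb_coord X, ← S.emb_coord Y, ← S.emb_coord Z]
  simp only [map_add, LinearMap.add_apply]
  have k := fun i j l => key i j l (S.coord i X) (S.coord j Y) (S.coord l Z)
  linear_combination (norm := module) k 0 0 0 + k 0 0 1 + k 0 1 0 + k 0 1 1 + k 1 0 0 + k 1 0 1 +
    k 1 1 0 + k 1 1 1

end

/-! ### Traceless curvature tensors -/

section

variable {G G' : LieSubalgebra ℝ (Module.End ℝ V)} {J J' : Fin 3 → Module.End ℝ V}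
  {E : Type*} [AddCommGroup E] [Module ℝ E]

/-- For aut(H)-valued tensors Ric is skew, hence determined by the trace of R. -/
theorem mem_weylH (h : Corresponds G J) {R : Tens V} :
    R ∈ weylH J ↔ R ∈ curv (autH J) ∧ ∀ X Y, LinearMap.trace ℝ V (R X Y) = 0 := by
  refine ⟨fun hR => ⟨hR.1, fun X Y => ?_⟩, fun hR => ⟨hR.1, ?_⟩⟩
  · have h0 : ric R = 0 := hR.2
    rw [trace_curv hR.1, h0]
    simp
  · change ric R = 0
    ext X Y
    have h1 := trace_curv hR.1 X Y
    have h2 : ric R X Y = -ric R Y X := (ric_mem_skewHerm h hR.1).1 X Y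
    rw [hR.2] at h1
    rw [LinearMap.zero_apply, LinearMap.zero_apply]
    linarith

/-- Transport of a splitting along `E ≃ E'`. -/
def Splitting.congr {E' : Type*} [AddCommGroup E'] [Module ℝ E'] (S : Splitting J E)
    (e : E ≃ₗ[ℝ] E') : Splitting J E' where
  emb i := S.emb i ∘ₗ e.symm
  coord i := e ∘ₗ S.coord i
  coord_emb i j x := by
    simp [S.coord_emb]
    split_ifs <;> simp
  emb_coord X := by simp [S.emb_coord]
  J0_emb0 x := by simp [S.J0_emb0]
  J0_emb1 x := by simp [S.J0_emb1]
  J1_emb0 x := by simp [S.J1_emb0]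
  J1_emb1 x := by simp [S.J1_emb1]
  J2_emb0 x := by simp [S.J2_emb0]
  J2_emb1 x := by simp [S.J2_emb1]

theorem IsParahypercomplex.exists_splitting [FiniteDimensional ℝ V] (h : IsParahypercomplex J)
    {m : ℕ} (hV : Module.finrank ℝ V = 2 * m) :
    Nonempty (Splitting J (EuclideanSpace ℝ (Fin m))) := by
  have h1 := h.splitting.finrank_eq
  have h2 : Module.finrank ℝ (LinearMap.ker (J 1 - 1)) =
      Module.finrank ℝ (EuclideanSpace ℝ (Fin m)) := by
    rw [finrank_euclideanSpace, Fintype.card_fin]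
    omega
  exact ⟨h.splitting.congr (LinearEquiv.ofFinrankEq _ _ h2)⟩

theorem Splitting.trace_lift [FiniteDimensional ℝ V] [FiniteDimensional ℝ E] (S : Splitting J E)
    (A : Module.End ℝ E) : LinearMap.trace ℝ V (S.lift A) = 2 * LinearMap.trace ℝ E A := by
  have h : ∀ i, LinearMap.trace ℝ V (S.emb i ∘ₗ A ∘ₗ S.coord i) = LinearMap.trace ℝ E A := by
    intro i
    rw [LinearMap.trace_comp_comm']
    congr 1
    ext x
    simp
  rw [lift, map_add, h, h]
  ring

theorem Splitting.pureTens_mem_weylH [FiniteDimensional ℝ V] [FiniteDimensional ℝ E]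
    (S : Splitting J E) (h : Corresponds G J) {α : E →ₗ[ℝ] ℝ} {e : E} (h0 : α e = 0) :
    S.pureTens α e ∈ weylH J := by
  have e1 : ∀ X Y, S.pureTens α e X Y = (α (S.coord 0 X) * α (S.coord 1 Y) -
      α (S.coord 1 X) * α (S.coord 0 Y)) • S.lift (α.smulRight e) := fun X Y => by
    ext Z
    exact S.pureTens_apply α e X Y Z
  refine (mem_weylH h).2 ⟨⟨fun X => ?_, fun X Y => ?_, fun X Y Z => ?_⟩, fun X Y => ?_⟩
  · rw [e1, sub_eq_zero.2 (mul_comm _ _), zero_smul]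
  · rw [e1]
    exact (autH J).smul_mem _ (S.lift_mem_autH _)
  · simp only [e1, lift, LinearMap.smul_apply, LinearMap.add_apply, LinearMap.comp_apply,
      LinearMap.smulRight_apply, map_smul]
    module
  · rw [e1, map_smul, S.trace_lift, LinearMap.trace_smulRight, h0]
    simp

theorem Splitting.weylH_ne_bot [FiniteDimensional ℝ V] [FiniteDimensional ℝ E]
    (S : Splitting J E) (hE : 2 ≤ Module.finrank ℝ E) (h : Corresponds G J) : weylH J ≠ ⊥ := by
  let b := Module.finBasis ℝ E
  let i : Fin (Module.finrank ℝ E) := ⟨0, by omega⟩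
  let j : Fin (Module.finrank ℝ E) := ⟨1, by omega⟩
  have hij : i ≠ j := by simp [i, j]
  refine (Submodule.ne_bot_iff _).2 ⟨S.pureTens (b.coord i) (b j), S.pureTens_mem_weylH h ?_,
    S.pureTens_ne_zero (fun h0 => ?_) (b.ne_zero j)⟩
  · simp [hij.symm]
  · simpa using LinearMap.congr_fun h0 (b i)

/-! ### Dimension four -/

theorem IsDual.exists_decomp (hd : IsDual G G') {L : Module.End ℝ V} (hL : L ∈ autG G) :
    ∃ t : ℝ, ∃ g ∈ G, ∃ g' ∈ G', L = t • 1 + g + g' := by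
  obtain ⟨a, ha, g, hg, g', hg', e⟩ := hd.decomp.exists_pair hL
  obtain ⟨t, rfl⟩ := Submodule.mem_span_singleton.1 ha
  exact ⟨t, g, hg, g', hg', e.symm⟩

theorem Corresponds.trace_eq_zero (h : Corresponds G J) {L : Module.End ℝ V} (hL : L ∈ G) :
    LinearMap.trace ℝ V L = 0 := by
  obtain ⟨c, rfl⟩ := h.mem_iff.1 hL
  simp [h.parahypercomplex.trace_eq_zero]

theorem Corresponds.le_autH (h : Corresponds G J) (hc : ∀ A ∈ G, ∀ B ∈ G', ⁅A, B⁆ = 0) :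
    G' ≤ autH J := fun B hB => mem_autH.2 fun a x => by
  have := LinearMap.congr_fun (hc _ (h.J_mem a) B hB) x
  simp only [LieRing.of_associative_ring_bracket, LinearMap.sub_apply, Module.End.mul_apply,
    LinearMap.zero_apply] at this
  exact (sub_eq_zero.1 this).symm

theorem Corresponds.eq_zero_of_mem [FiniteDimensional ℝ V] (h : Corresponds G J)
    {L : Module.End ℝ V} (hG : L ∈ G) (hL : L ∈ autH J) : L = 0 := by
  have := h.nontrivial
  obtain ⟨c, hc⟩ := h.mem_iff.1 hG
  have := (h.parahypercomplex.coeff_eq_zero ((autH J).neg_mem hL) (c := c) (by rw [hc]; simp)).2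
  simpa using this

/-- Identifies G' with the traceless part of aut(H): both structures are traceless, and G meets
aut(H) only in zero. -/
theorem mem_of_trace_eq_zero [FiniteDimensional ℝ V] (h : Corresponds G J)
    (h' : Corresponds G' J') (hc : ∀ A ∈ G, ∀ B ∈ G', ⁅A, B⁆ = 0)
    (hdec : ∀ L ∈ autG G, ∃ t : ℝ, ∃ g ∈ G, ∃ g' ∈ G', L = t • 1 + g + g')
    {A : Module.End ℝ V} (hA : A ∈ autH J) (ht : LinearMap.trace ℝ V A = 0) : A ∈ G' := by
  have := h.nontrivial
  have hd : (Module.finrank ℝ V : ℝ) ≠ 0 := by exact_mod_cast Module.finrank_pos.ne'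
  obtain ⟨t, g, hg, g', hg', rfl⟩ := hdec A (h.autH_le hA)
  rw [map_add, map_add, map_smul, h.trace_eq_zero hg, h'.trace_eq_zero hg', LinearMap.trace_one]
    at ht
  have ht0 : t = 0 := by simpa [hd] using ht
  subst ht0
  have hg0 : g = 0 := h.eq_zero_of_mem hg (by
    have := sub_mem hA (h.le_autH hc hg')
    simpa using this)
  simpa [hg0] using hg'

theorem curv_eq_weylH [FiniteDimensional ℝ V] (h : Corresponds G J)
    (h' : Corresponds G' J') (hc : ∀ A ∈ G, ∀ B ∈ G', ⁅A, B⁆ = 0)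
    (hdec : ∀ L ∈ autG G, ∃ t : ℝ, ∃ g ∈ G, ∃ g' ∈ G', L = t • 1 + g + g') :
    curv G' = weylH J := by
  ext R
  rw [mem_weylH h]
  refine ⟨fun hR => ⟨curv_mono (h.le_autH hc) hR, fun X Y => h'.trace_eq_zero (hR.2.1 X Y)⟩,
    fun hR => ⟨hR.1.1, fun X Y => ?_, hR.1.2.2⟩⟩
  exact mem_of_trace_eq_zero h h' hc hdec (hR.1.2.1 X Y) (hR.2 X Y)

/-! ### Commutants and dual structures. -/

theorem Splitting.finrank_autH_le [FiniteDimensional ℝ V] (S : Splitting J E) :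
    Module.finrank ℝ (autH J).toSubmodule ≤ Module.finrank ℝ E * Module.finrank ℝ E := by
  have := S.finiteDimensional
  rw [← Module.finrank_linearMap ℝ ℝ E E]
  refine LinearMap.finrank_le_finrank_of_injective
    (f := compress (S.coord 0) (S.emb 0) ∘ₗ (autH J).toSubmodule.subtype) fun L L' hLL => ?_
  apply Subtype.ext
  rw [← S.exists_lift_eq L.2, ← S.exists_lift_eq L'.2]
  exact congrArg S.lift hLL

/-- In dimension four the commutant of a dual structure is `ℝ ⊕ G`. -/
theorem mem_autH_dual [FiniteDimensional ℝ V] (hV : Module.finrank ℝ V = 4)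
    (h : Corresponds G J) (h' : Corresponds G' J') (hc : ∀ A ∈ G, ∀ B ∈ G', ⁅A, B⁆ = 0)
    {A : Module.End ℝ V} (hA : A ∈ autH J') : ∃ t : ℝ, ∃ g ∈ G, A = t • 1 + g := by
  have := h.nontrivial
  have hp := h.parahypercomplex
  have hG : G ≤ autH J' := h'.le_autH fun B hB A hA => by rw [← lie_skew, hc A hA B hB, neg_zero]
  let v : Fin 4 → Module.End ℝ V := ![1, J 0, J 1, J 2]
  have hv : LinearIndependent ℝ v := by
    rw [Fintype.linearIndependent_iff]
    intro c hc'
    have h0 := hp.coeff_eq_zero ((autH J).smul_mem (c 0) one_mem_autH)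
      (c := ![c 1, c 2, c 3]) (by
        simpa [Fin.sum_univ_three, Fin.sum_univ_four, v, add_assoc] using hc')
    have e1 := congrFun h0.1 0
    have e2 := congrFun h0.1 1
    have e3 := congrFun h0.1 2
    have e0 := (smul_eq_zero.1 h0.2).resolve_right one_ne_zero
    simp at e1 e2 e3
    intro i
    fin_cases i <;> assumption
  have hle : Submodule.span ℝ (Set.range v) ≤ (autH J').toSubmodule := by
    rw [Submodule.span_le]
    rintro _ ⟨i, rfl⟩
    fin_cases i
    · exact one_mem_autH
    · exact hG (h.J_mem 0)
    · exact hG (h.J_mem 1)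
    · exact hG (h.J_mem 2)
  -- Dimension count: 1 and the `J a` are four independent elements of aut(H'), whose dimension is
  -- at most 2².
  have heq := Submodule.eq_of_le_of_finrank_le hle (by
    rw [finrank_span_eq_card hv]
    obtain ⟨S⟩ := h'.parahypercomplex.exists_splitting (m := 2) hV
    simpa using S.finrank_autH_le)
  have hA' : A ∈ Submodule.span ℝ (Set.range v) := heq ▸ hA
  obtain ⟨c, hc'⟩ := (Submodule.mem_span_range_iff_exists_fun ℝ).1 hA'
  refine ⟨c 0, c 1 • J 0 + c 2 • J 1 + c 3 • J 2, ?_, ?_⟩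
  · exact add_mem (add_mem (G.smul_mem _ (h.J_mem 0)) (G.smul_mem _ (h.J_mem 1)))
      (G.smul_mem _ (h.J_mem 2))
  · rw [← hc']
    simp [v, Fin.sum_univ_four, add_assoc]

theorem exists_decomp_dual [FiniteDimensional ℝ V] (hV : Module.finrank ℝ V = 4)
    (h : Corresponds G J) (h' : Corresponds G' J') (hc : ∀ A ∈ G, ∀ B ∈ G', ⁅A, B⁆ = 0)
    {L : Module.End ℝ V} (hL : L ∈ autG G') :
    ∃ t : ℝ, ∃ g' ∈ G', ∃ g ∈ G, L = t • 1 + g' + g := by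
  obtain ⟨A, hA, c, rfl⟩ := h'.autG_decomp hL
  obtain ⟨t, g, hg, rfl⟩ := mem_autH_dual hV h h' hc hA
  exact ⟨t, _, h'.mem_iff.2 ⟨c, rfl⟩, g, hg, by abel⟩

theorem IsDual.autG_eq [FiniteDimensional ℝ V] (hV : Module.finrank ℝ V = 4)
    (h : Corresponds G J) (h' : Corresponds G' J') (hd : IsDual G G') : autG G' = autG G := by
  have hG : G ≤ autH J' := h'.le_autH fun B hB A hA => by
    rw [← lie_skew, hd.commute A hA B hB, neg_zero]
  ext L
  constructor
  · intro hL
    obtain ⟨t, g', hg', g, hg, rfl⟩ := exists_decomp_dual hV h h' hd.commute hL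
    exact add_mem (add_mem ((autG G).smul_mem _ (h.autH_le one_mem_autH))
      (h.autH_le (h.le_autH hd.commute hg'))) (le_autG hg)
  · intro hL
    obtain ⟨t, g, hg, g', hg', rfl⟩ := hd.exists_decomp hL
    exact add_mem (add_mem ((autG G').smul_mem _ (h'.autH_le one_mem_autH))
      (h'.autH_le (hG hg))) (le_autG hg')

/-- The traceless part of `aut(H)`. -/
noncomputable def slH (J : Fin 3 → Module.End ℝ V) : LieSubalgebra ℝ (Module.End ℝ V) where
  toSubmodule := (autH J).toSubmodule ⊓ LinearMap.ker (LinearMap.trace ℝ V)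
  lie_mem' := fun {A B} hA hB => ⟨(autH J).lie_mem hA.1 hB.1, by
    change LinearMap.trace ℝ V ⁅A, B⁆ = 0
    rw [LieRing.of_associative_ring_bracket, map_sub, LinearMap.trace_mul_comm, sub_self]⟩

theorem mem_slH {L : Module.End ℝ V} :
    L ∈ slH J ↔ L ∈ autH J ∧ LinearMap.trace ℝ V L = 0 := Iff.rfl

theorem slH_isParaquaternionic [FiniteDimensional ℝ V] (hV : Module.finrank ℝ V = 4)
    (h : Corresponds G J) : IsParaquaternionic (slH J) := by
  have := h.nontrivial
  obtain ⟨S⟩ := h.parahypercomplex.exists_splitting (m := 2) hV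
  let b := (EuclideanSpace.basisFun (Fin 2) ℝ).toBasis
  let K : Matrix (Fin 2) (Fin 2) ℝ → Module.End ℝ V := fun M => S.lift (Matrix.toLinAlgEquiv b M)
  have hmul : ∀ M N, K M * K N = K (M * N) := fun M N => by
    simp only [K]
    rw [← S.lift_mul, map_mul]
  have hsmul : ∀ (c : ℝ) M, K (c • M) = c • K M := fun c M => by
    simp only [K]
    rw [map_smul, S.lift_smul]
  have hadd : ∀ M N, K (M + N) = K M + K N := fun M N => by
    simp only [K]
    rw [map_add, S.lift_add]
  have hone : K 1 = 1 := by
    simp only [K]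
    rw [map_one, S.lift_one]
  have htr : ∀ M, LinearMap.trace ℝ V (K M) = 2 * M.trace := fun M => by
    simp only [K]
    rw [S.trace_lift, LinearMap.trace_eq_matrix_trace ℝ b]
    congr 2
    exact LinearMap.toMatrixAlgEquiv_toLinAlgEquiv b M
  -- The matrices by which the `J a` act on ℝ², now acting on E, which is itself a plane.
  let M : Fin 3 → Matrix (Fin 2) (Fin 2) ℝ :=
    ![!![0, -1; 1, 0], !![1, 0; 0, -1], !![0, 1; 1, 0]]
  have hMp : IsParahypercomplex fun a => K (M a) := by
    constructor
    · intro a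
      rw [hmul, ← hone, ← hsmul]
      congr 1
      fin_cases a <;> ext i j <;> fin_cases i <;> fin_cases j <;> simp [M]
    · intro a
      rw [hmul, ← hsmul]
      congr 1
      fin_cases a <;> ext i j <;> fin_cases i <;> fin_cases j <;> simp [M]
  refine ⟨_, hMp, hMp.linearIndependent, le_antisymm ?_ ?_⟩
  · rw [Submodule.span_le]
    rintro _ ⟨a, rfl⟩
    refine mem_slH.2 ⟨S.lift_mem_autH _, ?_⟩
    rw [htr]
    fin_cases a <;> simp [M, Matrix.trace_fin_two]
  · intro L hL
    obtain ⟨hLa, hLt⟩ := mem_slH.1 hL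
    obtain ⟨N, hN⟩ : ∃ N, K N = L := by
      refine ⟨(Matrix.toLinAlgEquiv b).symm (S.coord 0 ∘ₗ L ∘ₗ S.emb 0), ?_⟩
      simp only [K]
      rw [AlgEquiv.apply_symm_apply, S.exists_lift_eq hLa]
    rw [← hN, htr, Matrix.trace_fin_two] at hLt
    have e : N = ((N 1 0 - N 0 1) / 2) • M 0 + N 0 0 • M 1 + ((N 1 0 + N 0 1) / 2) • M 2 := by
      ext i j
      fin_cases i <;> fin_cases j <;> simp [M] <;> linarith
    rw [← hN, e, hadd, hadd, hsmul, hsmul, hsmul]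
    have hs : ∀ a, K (M a) ∈ Submodule.span ℝ (Set.range fun a => K (M a)) := fun a =>
      Submodule.subset_span ⟨a, rfl⟩
    exact add_mem (add_mem (Submodule.smul_mem _ _ (hs 0)) (Submodule.smul_mem _ _ (hs 1)))
      (Submodule.smul_mem _ _ (hs 2))

theorem isDual_slH [FiniteDimensional ℝ V] (hV : Module.finrank ℝ V = 4)
    (h : Corresponds G J) : IsDual G (slH J) := by
  have := h.nontrivial
  have hd : (Module.finrank ℝ V : ℝ) ≠ 0 := by rw [hV]; norm_num
  refine ⟨slH_isParaquaternionic hV h, fun A hA B hB => ?_, isDirectSum_of _ _ ?_ ?_ ?_⟩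
  · obtain ⟨c, rfl⟩ := h.mem_iff.1 hA
    ext x
    have hB' := mem_autH.1 (mem_slH.1 hB).1
    simp [LieRing.of_associative_ring_bracket, Fin.sum_univ_three, hB']
  · simp only [Fin.forall_fin_succ, Matrix.cons_val_zero, Matrix.cons_val_succ, IsEmpty.forall_iff,
      and_true]
    refine ⟨?_, le_autG, fun L hL => h.autH_le hL.1⟩
    rw [Submodule.span_singleton_le_iff_mem]
    exact h.autH_le one_mem_autH
  · intro L hL
    obtain ⟨A, hA, c, rfl⟩ := h.autG_decomp hL
    let t := LinearMap.trace ℝ V A / Module.finrank ℝ V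
    refine ⟨![t • 1, ∑ a, c a • J a, A - t • 1], ?_, ?_⟩
    · simp only [Fin.forall_fin_succ, Matrix.cons_val_zero, Matrix.cons_val_succ,
        IsEmpty.forall_iff, and_true]
      refine ⟨Submodule.mem_span_singleton.2 ⟨t, rfl⟩, h.mem_iff.2 ⟨c, rfl⟩,
        sub_mem hA ((autH J).smul_mem t one_mem_autH), ?_⟩
      change LinearMap.trace ℝ V (A - t • 1) = 0
      rw [map_sub, map_smul, LinearMap.trace_one, smul_eq_mul, div_mul_cancel₀ _ hd, sub_self]
    · simp only [Fin.sum_univ_three, Matrix.cons_val]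
      abel
  · intro f hf hs
    simp only [Fin.forall_fin_succ, Matrix.cons_val_zero, Matrix.cons_val_succ,
        IsEmpty.forall_iff, and_true] at hf ⊢
    obtain ⟨h0, h1, h2⟩ := hf
    obtain ⟨t, ht⟩ := Submodule.mem_span_singleton.1 h0
    replace h1 : f 1 ∈ G := h1
    replace h2 : f 2 ∈ slH J := h2
    rw [Fin.sum_univ_three, ← ht] at hs
    have hs' := congrArg (LinearMap.trace ℝ V) hs
    rw [map_add, map_add, map_smul, h.trace_eq_zero h1, (mem_slH.1 h2).2, LinearMap.trace_one,
      map_zero] at hs'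
    have ht0 : t = 0 := by simpa [hd] using hs'
    rw [ht0, zero_smul, zero_add] at hs
    have h1' : f 1 = 0 := h.eq_zero_of_mem h1 (by
      rw [eq_neg_of_add_eq_zero_left hs]
      exact neg_mem (mem_slH.1 h2).1)
    rw [h1', zero_add] at hs
    exact ⟨by rw [← ht, ht0, zero_smul], h1', hs⟩

theorem weyl_isDirectSum_of_isDual [FiniteDimensional ℝ V] (hV : Module.finrank ℝ V = 4)
    (h : Corresponds G J) (h' : Corresponds G' J') (hd : IsDual G G') :
    IsDirectSum ![curv G, curv G'] (weyl G) := by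
  have hc' : ∀ B ∈ G', ∀ A ∈ G, ⁅B, A⁆ = 0 := fun B hB A hA => by
    rw [← lie_skew, hd.commute A hA B hB, neg_zero]
  have e := curv_eq_weylH h h' hd.commute fun L hL => hd.exists_decomp hL
  -- Applying the identification with the roles exchanged shows that G-valued curvature tensors are
  -- Ricci-flat.
  have e' := curv_eq_weylH h' h hc' fun L hL => exists_decomp_dual hV h h' hd.commute hL
  have hle : curv G ≤ weyl G := by
    refine fun R hR => ⟨curv_mono le_autG hR, ?_⟩
    rw [e'] at hR
    exact hR.2
  obtain ⟨S⟩ := h.parahypercomplex.exists_splitting (m := 2) hV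
  refine isDirectSum_pair hle (e ▸ weylH_le_weyl h) (fun R hR => ?_) fun R hR hR' => ?_
  · have hg := gPart_mem_curv S h hV hR
    refine ⟨R - gPart J R, ?_, by rwa [sub_sub_cancel]⟩
    have hsub := sub_mem hR (hle hg)
    refine ⟨hsub.1.1, fun X Y => mem_of_trace_eq_zero h h' hd.commute
      (fun L hL => hd.exists_decomp hL) ?_ ?_, hsub.1.2.2⟩
    · have := sub_omega_mem h hR.1 X Y
      rwa [← gPart_apply] at this
    · have h0 : ric (R - gPart J R) = 0 := hsub.2
      rw [trace_curv hsub.1, h0]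
      simp
  · ext X Y : 2
    exact h.eq_zero_of_mem (hR.2.1 X Y) (h.le_autH hd.commute (hR'.2.1 X Y))

end

end ParaQuaternion

/-! ### The main theorem. -/

open ParaQuaternion

theorem theorem4p1 {V : Type*} [AddCommGroup V] [Module ℝ V] [FiniteDimensional ℝ V]
    (n : ℕ) (hn : 1 ≤ n) (hV : Module.finrank ℝ V = 4 * n)
    (G : LieSubalgebra ℝ (Module.End ℝ V)) (J : Fin 3 → Module.End ℝ V)
    (hGJ : ParaQuaternion.Corresponds G J) :
    (ParaQuaternion.IsDirectSum
        ![ParaQuaternion.weyl G, ParaQuaternion.rSymHerm G J, ParaQuaternion.rSymMix J,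
          ParaQuaternion.rSkewHerm G J, ParaQuaternion.rSkewMix J]
        (ParaQuaternion.curv (ParaQuaternion.autG G)) ∧
      ParaQuaternion.IsIrredSubmodule (ParaQuaternion.autG G) (ParaQuaternion.rSymHerm G J) ∧
      ParaQuaternion.IsIrredSubmodule (ParaQuaternion.autG G) (ParaQuaternion.rSymMix J) ∧
      ParaQuaternion.IsIrredSubmodule (ParaQuaternion.autG G) (ParaQuaternion.rSkewHerm G J) ∧
      ParaQuaternion.IsIrredSubmodule (ParaQuaternion.autG G) (ParaQuaternion.rSkewMix J)) ∧
    (2 ≤ n →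
      ParaQuaternion.IsIrredSubmodule (ParaQuaternion.autG G) (ParaQuaternion.weyl G) ∧
      ParaQuaternion.IsDirectSum
        ![ParaQuaternion.weyl G, ParaQuaternion.rSkewHerm G J]
        (ParaQuaternion.curv (ParaQuaternion.autH J)) ∧
      ParaQuaternion.IsIrredSubmodule (ParaQuaternion.autH J) (ParaQuaternion.weyl G) ∧
      ParaQuaternion.IsIrredSubmodule (ParaQuaternion.autH J) (ParaQuaternion.rSkewHerm G J)) ∧
    (n = 1 →
      (∃ G' : LieSubalgebra ℝ (Module.End ℝ V), ParaQuaternion.IsDual G G') ∧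
      ∀ G' : LieSubalgebra ℝ (Module.End ℝ V), ParaQuaternion.IsDual G G' →
        ParaQuaternion.IsDirectSum ![ParaQuaternion.curv G, ParaQuaternion.curv G']
          (ParaQuaternion.weyl G) ∧
        ParaQuaternion.IsIrredSubmodule (ParaQuaternion.autG G) (ParaQuaternion.curv G) ∧
        ParaQuaternion.IsIrredSubmodule (ParaQuaternion.autG G) (ParaQuaternion.curv G') ∧
        ParaQuaternion.IsDirectSum
          ![ParaQuaternion.curv G', ParaQuaternion.rSkewHerm G J]
          (ParaQuaternion.curv (ParaQuaternion.autH J)) ∧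
        ParaQuaternion.IsIrredSubmodule (ParaQuaternion.autH J) (ParaQuaternion.curv G') ∧
        ParaQuaternion.IsIrredSubmodule (ParaQuaternion.autH J) (ParaQuaternion.rSkewHerm G J)) := by

  have hp := hGJ.parahypercomplex
  obtain ⟨S⟩ := hp.exists_splitting (m := 2 * n) (by omega)
  have hE : 2 ≤ Module.finrank ℝ (EuclideanSpace ℝ (Fin (2 * n))) := by
    rw [finrank_euclideanSpace, Fintype.card_fin]
    omega
  have hmin := weylH_isMinimal S (S.weylH_ne_bot hE hGJ)
  have hK := skewHerm_isMinimal S hE hGJ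
  have hKi := rSkewHerm_invariant hGJ
  have hKH : IsIrredSubmodule (autH J) (rSkewHerm G J) :=
    hK.isIrredSubmodule (hKi.mono hGJ.autH_le)
  have hds := curv_autH_isDirectSum hGJ
  refine ⟨⟨curv_autG_isDirectSum hGJ, ?_, ?_, ?_, ?_⟩, fun hn2 => ?_, fun hn1 => ⟨?_, ?_⟩⟩
  · exact ((symHerm_isMinimal S hE hGJ).mono hGJ.autH_le).isIrredSubmodule
      (rSymHerm_invariant hGJ)
  · exact (symMix_isMinimal S hE hGJ).isIrredSubmodule (rSymMix_invariant hGJ)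
  · exact (hK.mono hGJ.autH_le).isIrredSubmodule hKi
  · exact (skewMix_isMinimal S hE hGJ).isIrredSubmodule (rSkewMix_invariant hGJ)
  · have hw := weyl_eq_weylH S hGJ (by omega)
    rw [← hw] at hmin hds
    exact ⟨(hmin.mono hGJ.autH_le).isIrredSubmodule weyl_invariant, hds,
      hmin.isIrredSubmodule (weyl_invariant.mono hGJ.autH_le), hKH⟩
  · exact ⟨_, isDual_slH (by omega) hGJ⟩
  · have hV4 : Module.finrank ℝ V = 4 := by omega
    intro G' hd
    obtain ⟨J', h'⟩ := hd.paraquaternionic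
    obtain ⟨S'⟩ := h'.parahypercomplex.exists_splitting (m := 2 * n) (by omega)
    -- The Weyl argument for the dual structure yields the irreducibility of R(G), since R(G) is the
    -- Ricci-flat part for aut(H') and aut(G') = aut(G).
    have hmin' := weylH_isMinimal S' (S'.weylH_ne_bot hE h')
    have hc' : ∀ B ∈ G', ∀ A ∈ G, ⁅B, A⁆ = 0 := fun B hB A hA => by
      rw [← lie_skew, hd.commute A hA B hB, neg_zero]
    have hA : autG G' = autG G := hd.autG_eq hV4 hGJ h'
    rw [← curv_eq_weylH hGJ h' hd.commute fun L hL => hd.exists_decomp hL] at hmin hds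
    rw [← curv_eq_weylH h' hGJ hc' fun L hL => exists_decomp_dual hV4 hGJ h' hd.commute hL]
      at hmin'
    have hi' : Invariant (autG G) (curv G') := hA ▸ curv_invariant
    exact ⟨weyl_isDirectSum_of_isDual hV4 hGJ h' hd,
      (hmin'.mono (hA ▸ h'.autH_le)).isIrredSubmodule curv_invariant,
      (hmin.mono hGJ.autH_le).isIrredSubmodule hi', hds,
      hmin.isIrredSubmodule (hi'.mono hGJ.autH_le), hKH⟩
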